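/- Let $K$ be an algebraically closed field, let $Q$ be a finite connected quiver such that at most two arrows start and at most two arrows end at each vertex, and let $\Lambda = KQ/I$, where $I$ is an admissible ideal of the path algebra $KQ$ (that is, $R^m\subseteq I\subseteq R^2$ for some $m\ge 2$, where $R$ is the ideal generated by the arrows). Assume that - $\Lambda$ is tame, i.e. for each $d$ there are finitely many $K[X]$-$\Lambda$-bimodules $M_1,\dots,M_n$, finitely generated and free over $K[X]$ (with $K$ acting centrally), such that all but finitely many isomorphism classes of indecomposable right $\Lambda$-modules of dimension $d$ are of the form $K[X]/(X-\lambda)\otimes_{K[X]}M_k$ with $\lambda\in K$; - $\Lambda$ is symmetric, i.e. it admits a nondegenerate symmetric associative $K$-bilinear form $\Lambda\times\Lambda\to K$; - $\Lambda$ is periodic of period four, i.e. $4$ is the least $d\ge 1$ with $\Omega^d(\Lambda)\cong\Lambda$ as $\Lambda$-$\Lambda$-bimodules, where $\Omega$ denotes the syzygy (the kernel of a projective cover); - $\Lambda$ has infinite representation type, i.e. it does not have only finitely many isomorphism classes of finitely generated indecomposable right modules. Call a vertex an $m$-vertex if exactly $m$ arrows end at it and exactly $m$ arrows start at it. Let $i$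 be a $1$-vertex of $Q$ which is part of a triangle, i.e. there are arrows $\gamma\colon x\to i$, $\alpha\colon i\to j$ and $\beta\colon j\to x$ in $Q$. Then both $x$ and $j$ are $2$-vertices. -/

import Mathlib

open scoped TensorProduct Polynomial

universe w u v

noncomputable section

/-! ### Path algebras and admissible ideals -/

/-- All paths of a quiver, including the trivial path at each vertex. -/
abbrev AllPaths (V : Type u) [Quiver.{v} V] : Type (max u v) :=
  Σ a b : V, Quiver.Path a b

/-- The path algebra `KQ`: the `K`-vector space with basis the set of all paths of the quiver.
Paths are composed from left to right. -/
def PathAlgebra (K : Type w) [Field K] (V : Type u) [Quiver.{v} V] : Type (max u v w) :=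
  AllPaths V →₀ K

namespace PathAlgebra

variable {K : Type w} [Field K] {V : Type u} [Quiver.{v} V]

instance : AddCommGroup (PathAlgebra K V) := inferInstanceAs (AddCommGroup (AllPaths V →₀ K))

instance : Module K (PathAlgebra K V) := inferInstanceAs (Module K (AllPaths V →₀ K))

variable (K V) in
/-- The basis of the path algebra consisting of all paths. -/
def pathBasis : Module.Basis (AllPaths V) K (PathAlgebra K V) :=
  Module.Basis.ofRepr (LinearEquiv.refl K (AllPaths V →₀ K))

/-- The basis element of the path algebra given by a path. -/
def ofPath {a b : V} (p : Quiver.Path a b) : PathAlgebra K V :=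
  pathBasis K V ⟨a, b, p⟩

open Classical in
/-- The product of two paths: their concatenation if the first ends where the second starts,
and zero otherwise. -/
def pathMul (p q : AllPaths V) : PathAlgebra K V :=
  if h : q.1 = p.2.1 then ofPath (p.2.2.comp (q.2.2.cast h rfl)) else 0

/-- The bilinear extension of the product of paths. -/
def mulBilin : PathAlgebra K V →ₗ[K] PathAlgebra K V →ₗ[K] PathAlgebra K V :=
  (pathBasis K V).constr K fun p => (pathBasis K V).constr K fun q => pathMul p q

instance : Mul (PathAlgebra K V) := ⟨fun f g => mulBilin f g⟩

theorem mul_def (f g : PathAlgebra K V) : f * g = mulBilin f g := rfl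

theorem ofPath_mul_ofPath {a b c d : V} (p : Quiver.Path a b) (q : Quiver.Path c d) :
    (ofPath p * ofPath q : PathAlgebra K V) = pathMul ⟨a, b, p⟩ ⟨c, d, q⟩ := by
  simp only [mul_def, mulBilin, ofPath, Module.Basis.constr_basis]

theorem ofPath_mul_comp {a b c : V} (p : Quiver.Path a b) (q : Quiver.Path b c) :
    (ofPath p * ofPath q : PathAlgebra K V) = ofPath (p.comp q) := by
  rw [ofPath_mul_ofPath, pathMul, dif_pos rfl]
  rfl

theorem ofPath_mul_of_ne {a b c d : V} (p : Quiver.Path a b) (q : Quiver.Path c d) (h : c ≠ b) :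
    (ofPath p * ofPath q : PathAlgebra K V) = 0 := by
  rw [ofPath_mul_ofPath, pathMul, dif_neg h]

theorem induction_ofPath {P : PathAlgebra K V → Prop} (f : PathAlgebra K V) (h0 : P 0)
    (hadd : ∀ f g, P f → P g → P (f + g))
    (hsmul : ∀ (c : K) (a b : V) (p : Quiver.Path a b), P (c • ofPath p)) : P f := by
  rw [← (pathBasis K V).linearCombination_repr f, Finsupp.linearCombination_apply]
  exact Finset.sum_induction _ P hadd h0 fun x _ => hsmul _ x.1 x.2.1 x.2.2

theorem add_mul_aux (f g h : PathAlgebra K V) : (f + g) * h = f * h + g * h := by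
  simp [mul_def]

theorem mul_add_aux (f g h : PathAlgebra K V) : f * (g + h) = f * g + f * h := by
  simp [mul_def]

theorem smul_mul_aux (c : K) (f g : PathAlgebra K V) : (c • f) * g = c • (f * g) := by
  simp [mul_def]

theorem mul_smul_aux (c : K) (f g : PathAlgebra K V) : f * (c • g) = c • (f * g) := by
  simp [mul_def]

theorem zero_mul_aux (f : PathAlgebra K V) : 0 * f = 0 := by
  simp [mul_def]

theorem mul_zero_aux (f : PathAlgebra K V) : f * 0 = 0 := by
  simp [mul_def]

theorem mul_assoc_aux (f g h : PathAlgebra K V) : f * g * h = f * (g * h) := by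
  induction f using induction_ofPath with
  | h0 => simp only [zero_mul_aux]
  | hadd f₁ f₂ h₁ h₂ => simp only [add_mul_aux, h₁, h₂]
  | hsmul c a b p =>
  induction g using induction_ofPath with
  | h0 => simp only [zero_mul_aux, mul_zero_aux]
  | hadd f₁ f₂ h₁ h₂ => simp only [add_mul_aux, mul_add_aux, h₁, h₂]
  | hsmul c' a' b' p' =>
  induction h using induction_ofPath with
  | h0 => simp only [mul_zero_aux]
  | hadd f₁ f₂ h₁ h₂ => simp only [mul_add_aux, h₁, h₂]
  | hsmul c'' a'' b'' p'' =>
  simp only [smul_mul_aux, mul_smul_aux]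
  congr 3
  by_cases h₁ : a' = b
  · subst h₁
    by_cases h₂ : a'' = b'
    · subst h₂
      simp only [ofPath_mul_comp, Quiver.Path.comp_assoc]
    · simp only [ofPath_mul_comp, ofPath_mul_of_ne _ _ h₂, mul_zero_aux]
  · by_cases h₂ : a'' = b'
    · subst h₂
      simp only [ofPath_mul_comp, ofPath_mul_of_ne _ _ h₁, zero_mul_aux]
    · simp only [ofPath_mul_of_ne _ _ h₁, ofPath_mul_of_ne _ _ h₂, zero_mul_aux, mul_zero_aux]

section Unital

variable [Fintype V]

/-- The identity is the sum of the trivial paths. -/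
instance : One (PathAlgebra K V) := ⟨∑ a : V, ofPath (Quiver.Path.nil : Quiver.Path a a)⟩

theorem one_def : (1 : PathAlgebra K V) = ∑ a : V, ofPath (Quiver.Path.nil : Quiver.Path a a) :=
  rfl

theorem one_mul_aux (f : PathAlgebra K V) : 1 * f = f := by
  induction f using induction_ofPath with
  | h0 => simp only [mul_zero_aux]
  | hadd f₁ f₂ h₁ h₂ => simp only [mul_add_aux, h₁, h₂]
  | hsmul c a b p =>
    rw [mul_smul_aux, one_def, mul_def, map_sum, LinearMap.sum_apply]
    simp only [← mul_def]
    rw [Finset.sum_eq_single a, ofPath_mul_comp, Quiver.Path.nil_comp]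
    · intro d _ hd
      exact ofPath_mul_of_ne _ _ hd.symm
    · simp

theorem mul_one_aux (f : PathAlgebra K V) : f * 1 = f := by
  induction f using induction_ofPath with
  | h0 => simp only [zero_mul_aux]
  | hadd f₁ f₂ h₁ h₂ => simp only [add_mul_aux, h₁, h₂]
  | hsmul c a b p =>
    rw [smul_mul_aux, one_def, mul_def, map_sum]
    simp only [← mul_def]
    rw [Finset.sum_eq_single b, ofPath_mul_comp, Quiver.Path.comp_nil]
    · intro d _ hd
      exact ofPath_mul_of_ne _ _ hd
    · simp

instance : Ring (PathAlgebra K V) :=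
  { (inferInstance : AddCommGroup (PathAlgebra K V)),
    (inferInstance : Mul (PathAlgebra K V)),
    (inferInstance : One (PathAlgebra K V)) with
    left_distrib := mul_add_aux
    right_distrib := add_mul_aux
    zero_mul := zero_mul_aux
    mul_zero := mul_zero_aux
    mul_assoc := mul_assoc_aux
    one_mul := one_mul_aux
    mul_one := mul_one_aux }

instance : Algebra K (PathAlgebra K V) :=
  Algebra.ofModule smul_mul_aux mul_smul_aux

end Unital

variable (K V) in
/-- The arrow ideal `R` of the path algebra, spanned by all paths of length at least one. -/
def arrowIdeal : Submodule K (PathAlgebra K V) :=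
  Submodule.span K {f | ∃ (a b : V) (p : Quiver.Path a b), 1 ≤ p.length ∧ f = ofPath p}

/-- A two-sided ideal `I` of the path algebra is admissible if `R ^ m ⊆ I ⊆ R ^ 2` for some
`m ≥ 2`, where `R` is the arrow ideal. -/
def IsAdmissible [Fintype V] (I : Ideal (PathAlgebra K V)) [I.IsTwoSided] : Prop :=
  I.restrictScalars K ≤ arrowIdeal K V ^ 2 ∧
    ∃ m : ℕ, 2 ≤ m ∧ arrowIdeal K V ^ m ≤ I.restrictScalars K

end PathAlgebra

/-! ### Vertices of a quiver -/

/-- `i` is an `m`-vertex (`m`-regular): exactly `m` arrows end at `i` and exactly `m` arrows start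
at `i`. -/
def IsRegularVertex {V : Type u} [Quiver.{v} V] (m : ℕ) (i : V) : Prop :=
  Nat.card (Quiver.Costar i) = m ∧ Nat.card (Quiver.Star i) = m

/-- A (finite) quiver is biserial if at most two arrows end and at most two arrows start at each
vertex. -/
def IsBiserialQuiver (V : Type u) [Quiver.{v} V] : Prop :=
  ∀ i : V, Nat.card (Quiver.Costar i) ≤ 2 ∧ Nat.card (Quiver.Star i) ≤ 2

/-- A quiver is connected if its underlying undirected graph is. -/
def IsConnectedQuiver (V : Type u) [Quiver.{v} V] : Prop :=
  Nonempty V ∧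
    ∀ a b : V, Quiver.WeaklyConnectedComponent.mk a = Quiver.WeaklyConnectedComponent.mk b

/-! ### Representation type

Right modules over `A` are modules over `Aᵐᵒᵖ`. -/

/-- A nonzero module that is not the direct sum of two nonzero submodules. -/
def IsIndecomposableModule (R : Type u) [Ring R] (M : Type v) [AddCommGroup M] [Module R M] : Prop :=
  Nontrivial M ∧ ∀ N N' : Submodule R M, IsCompl N N' → N = ⊥ ∨ N' = ⊥

/-- Finite representation type: up to isomorphism there are only finitely many finitely generated
indecomposable right modules. -/
def IsFiniteRepType (A : Type u) [Ring A] : Prop :=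
  ∃ (n : ℕ) (E : Fin n → ModuleCat.{u} Aᵐᵒᵖ), ∀ N : ModuleCat.{u} Aᵐᵒᵖ,
    Module.Finite Aᵐᵒᵖ N → IsIndecomposableModule Aᵐᵒᵖ N → ∃ k, Nonempty (N ≃ₗ[Aᵐᵒᵖ] E k)

/-- A `K[X]`-`A`-bimodule on which `K` acts centrally, finitely generated and free as a left
`K[X]`-module. -/
structure FreePolyBimodule (K : Type w) [Field K] (A : Type u) [Ring A] [Algebra K A] where
  carrier : Type u
  [addCommGroup : AddCommGroup carrier]
  [polyModule : Module K[X] carrier]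
  [rightModule : Module Aᵐᵒᵖ carrier]
  [smulCommClass : SMulCommClass K[X] Aᵐᵒᵖ carrier]
  central : ∀ (c : K) (m : carrier),
    (Polynomial.C c : K[X]) • m = (algebraMap K Aᵐᵒᵖ c) • m
  free : Module.Free K[X] carrier
  finite : Module.Finite K[X] carrier

attribute [instance] FreePolyBimodule.addCommGroup FreePolyBimodule.polyModule
  FreePolyBimodule.rightModule FreePolyBimodule.smulCommClass

/-- The specialization of a bimodule `M` at `c`: the right `A`-module
`M ⊗ K[X] / (X - c)`, tensored over `K[X]`. -/
abbrev FreePolyBimodule.specialize {K : Type w} [Field K] {A : Type u} [Ring A] [Algebra K A]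
    (M : FreePolyBimodule K A) (c : K) : Type (max u w) :=
  M.carrier ⊗[K[X]] (K[X] ⧸ Ideal.span {(Polynomial.X - Polynomial.C c : K[X])})

/-- Tameness of a finite-dimensional algebra: in every dimension `d`, all but finitely many
isomorphism classes of indecomposable right `A`-modules of dimension `d` are specializations of
finitely many `K[X]`-`A`-bimodules that are finitely generated free over `K[X]`. -/
def IsTameAlgebra (K : Type w) [Field K] (A : Type u) [Ring A] [Algebra K A] : Prop :=
  ∀ d : ℕ, ∃ (n : ℕ) (M : Fin n → FreePolyBimodule K A) (m : ℕ) (E : Fin m → ModuleCat.{u} Aᵐᵒᵖ),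
    ∀ (N : Type u) [AddCommGroup N] [Module K N] [Module Aᵐᵒᵖ N] [IsScalarTower K Aᵐᵒᵖ N],
      Module.Finite K N → Module.finrank K N = d → IsIndecomposableModule Aᵐᵒᵖ N →
        (∃ k, Nonempty (N ≃ₗ[Aᵐᵒᵖ] E k)) ∨
          ∃ (k : Fin n) (c : K), Nonempty (N ≃ₗ[Aᵐᵒᵖ] (M k).specialize c)

/-! ### Symmetric algebras -/

/-- A symmetric algebra: there is a nondegenerate symmetric associative `K`-bilinear form. -/
def IsSymmetricKAlgebra (K : Type w) [Field K] (A : Type u) [Ring A] [Algebra K A] : Prop :=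
  ∃ B : A →ₗ[K] A →ₗ[K] K, (∀ a b, B a b = B b a) ∧ (∀ a b c, B (a * b) c = B a (b * c)) ∧
    ∀ a, (∀ b, B a b = 0) → a = 0

/-! ### Syzygies and periodic algebras -/

/-- A projective cover: a surjection from a projective module with superfluous kernel. -/
def IsProjectiveCover {R : Type u} [Ring R] {P M : ModuleCat.{v} R} (π : P →ₗ[R] M) : Prop :=
  Module.Projective R P ∧ Function.Surjective π ∧
    ∀ N : Submodule R P, N ⊔ LinearMap.ker π = ⊤ → N = ⊤

/-- `N` is isomorphic to the syzygy of `M`, the kernel of a projective cover of `M`. -/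
def IsSyzygy {R : Type u} [Ring R] (M N : ModuleCat.{v} R) : Prop :=
  ∃ (P : ModuleCat.{v} R) (π : P →ₗ[R] M), IsProjectiveCover π ∧
    Nonempty (N ≃ₗ[R] LinearMap.ker π)

/-- `N` is isomorphic to the `n`-th syzygy of `M`. -/
def IsNthSyzygy {R : Type u} [Ring R] : ℕ → ModuleCat.{v} R → ModuleCat.{v} R → Prop
  | 0, M, N => Nonempty (N ≃ₗ[R] M)
  | n + 1, M, N => ∃ L : ModuleCat.{v} R, IsSyzygy M L ∧ IsNthSyzygy n L N

/-- `M` is a periodic module of period `d`: `d` is the least positive integer for which the `d`-th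
syzygy of `M` is isomorphic to `M`. -/
def IsPeriodicModule {R : Type u} [Ring R] (d : ℕ) (M : ModuleCat.{v} R) : Prop :=
  IsLeast {n : ℕ | 1 ≤ n ∧ IsNthSyzygy n M M} d

/-- `A` as an `A`-`A`-bimodule, that is, as a module over its enveloping algebra `A ⊗[K] Aᵐᵒᵖ`,
where `a ⊗ b` acts by `x ↦ a * x * b`. -/
def regularBimodule (K : Type w) [Field K] (A : Type u) [Ring A] [Algebra K A] :
    ModuleCat.{u} (A ⊗[K] Aᵐᵒᵖ) :=
  letI : Module (A ⊗[K] Aᵐᵒᵖ) A := instModuleTensorProductMop K A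
  ModuleCat.of (A ⊗[K] Aᵐᵒᵖ) A

/-- `A` is a periodic algebra of period `d`: it is periodic of period `d` as a bimodule. -/
def IsPeriodicAlgebra (K : Type w) [Field K] (A : Type u) [Ring A] [Algebra K A] (d : ℕ) : Prop :=
  IsPeriodicModule d (regularBimodule K A)

/-- Tame symmetric algebras of period four. -/
structure IsTSP4 (K : Type w) [Field K] (A : Type u) [Ring A] [Algebra K A] : Prop where
  tame : IsTameAlgebra K A
  symmetric : IsSymmetricKAlgebra K A
  periodic : IsPeriodicAlgebra K A 4

end

/-!
Tensoring a periodic bimodule resolution of a symmetric algebra `Λ` with a simple module `S a`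
gives a minimal projective resolution of `S a` whose fourth syzygy is `S a` again. As projective
`Λ`-modules are injective and `dim Hom(P, M) = dim Hom(M, P)` for `P` projective, the resolution
read backwards is a minimal injective one. So, with `n a c = dim Ext¹(S a, S c)`, the number of
arrows from `c` to `a`, and the Cartan numbers `p b c = dim e b Λ e c`, the middle terms of the
resolution are the sums of the `P c` with multiplicities `n a c` and `n c a`. Writing `ωₖ` for the
dimension of `Hom(P b, Ωᵏ(S a))`, this reads
`∑ c, n a c * p b c = ω₁ + ω₂`, `∑ c, n c a * p b c = ω₂ + ω₃`, `p b a = ω₁ + δ = ω₃ + δ`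
with `δ = 1` if `a = b` and `δ = 0` otherwise. Hence the two sums agree, and they are at least
`p b a + n b a - δ` since `n b a ≤ ω₂`.

At a `1`-vertex `i` without loop on a triangle `x ⟶ i ⟶ j ⟶ x` this gives `p b x = p b j` for
all `b`, and `p j i < p j j`; if only one arrow started or ended at `x` or `j`, the relations at
that vertex would be contradictory. A loop at a `1`-vertex of a connected quiver makes `Λ` a
quotient of `K[X]`, which is of finite representation type.
-/

noncomputable section

open Module

/-! ### Dimensions of spaces of homomorphisms -/

section HomDimension

section VectorSpaces

variable {K U V W : Type*} [Field K] [AddCommGroup U] [Module K U] [AddCommGroup V] [Module K V]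
  [AddCommGroup W] [Module K W]

theorem finrank_ker_of_exact {f : U →ₗ[K] V} {g : V →ₗ[K] W} (hf : Function.Injective f)
    (hfg : Function.Exact f g) : finrank K (LinearMap.ker g) = finrank K U := by
  rw [hfg.linearMap_ker_eq, LinearMap.finrank_range_of_inj hf]

theorem finrank_eq_add_of_exact [FiniteDimensional K V] {f : U →ₗ[K] V} {g : V →ₗ[K] W}
    (hf : Function.Injective f) (hfg : Function.Exact f g) (hg : Function.Surjective g) :
    finrank K V = finrank K U + finrank K W := by
  rw [← g.finrank_range_add_finrank_ker, LinearMap.range_eq_top.2 hg, finrank_top,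
    finrank_ker_of_exact hf hfg, add_comm]

theorem finrank_ker_comp_of_surjective [FiniteDimensional K U] {f : U →ₗ[K] V} (g : V →ₗ[K] W)
    (hf : Function.Surjective f) :
    finrank K (LinearMap.ker (g ∘ₗ f)) =
      finrank K (LinearMap.ker f) + finrank K (LinearMap.ker g) := by
  have hrank : finrank K (LinearMap.range (g ∘ₗ f)) = finrank K (LinearMap.range g) := by
    rw [LinearMap.range_comp, LinearMap.range_eq_top.2 hf, Submodule.map_top]
  have : FiniteDimensional K V := .of_surjective f hf
  have := (g ∘ₗ f).finrank_range_add_finrank_ker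
  have := g.finrank_range_add_finrank_ker
  have := f.finrank_range_add_finrank_ker
  rw [LinearMap.range_eq_top.2 hf, finrank_top] at this
  lia

end VectorSpaces

variable {K R : Type*} [Field K] [Ring R] [Algebra K R]
  {L M N P Q S : Type*} [AddCommGroup L] [AddCommGroup M] [AddCommGroup N] [AddCommGroup P]
  [AddCommGroup Q] [AddCommGroup S] [Module R L] [Module R M] [Module R N] [Module R P]
  [Module R Q] [Module R S]

theorem surjective_lcomp_of_injective [Module K Q] [IsScalarTower K R Q] (hQ : Module.Baer R Q)
    {f : L →ₗ[R] M} (hf : Function.Injective f) : Function.Surjective (LinearMap.lcomp K Q f) :=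
  hQ.extension_property f hf

theorem exact_lcomp [Module K Q] [IsScalarTower K R Q] {f : L →ₗ[R] M} {g : M →ₗ[R] N}
    (hfg : Function.Exact f g) (hg : Function.Surjective g) :
    Function.Exact (LinearMap.lcomp K Q g) (LinearMap.lcomp K Q f) := by
  intro h
  refine ⟨fun hh => ⟨(LinearMap.range f).liftQ h (LinearMap.range_le_ker_iff.mpr hh) ∘ₗ
    (hfg.linearEquivOfSurjective hg).symm.toLinearMap, ?_⟩, ?_⟩
  · ext x
    simp
  · rintro ⟨k, rfl⟩
    exact LinearMap.ext fun x => by simp [hfg.apply_apply_eq_zero]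

theorem finrank_hom_congr_left {M' : Type*} [AddCommGroup M'] [Module R M'] [Module K N]
    [IsScalarTower K R N] (e : M ≃ₗ[R] M') :
    finrank K (M →ₗ[R] N) = finrank K (M' →ₗ[R] N) :=
  (e.congrLeft N K).finrank_eq

theorem finrank_hom_congr_right {N' : Type*} [AddCommGroup N'] [Module R N'] [Module K N]
    [IsScalarTower K R N] [Module K N'] [IsScalarTower K R N'] (e : N ≃ₗ[R] N') :
    finrank K (M →ₗ[R] N) = finrank K (M →ₗ[R] N') :=
  (LinearEquiv.ofBijective (LinearMap.compRight K e.toLinearMap)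
    ⟨e.injective.injective_linearMapComp_left,
      fun h => ⟨e.symm.toLinearMap ∘ₗ h, by ext; simp⟩⟩).finrank_eq

variable [Module K L] [IsScalarTower K R L] [Module K M] [IsScalarTower K R M]

theorem exact_compRight [Module K N] [IsScalarTower K R N] {f : L →ₗ[R] M} {g : M →ₗ[R] N}
    (hf : Function.Injective f) (hfg : Function.Exact f g) :
    Function.Exact (LinearMap.compRight K f : (P →ₗ[R] L) →ₗ[K] P →ₗ[R] M)
      (LinearMap.compRight K g : (P →ₗ[R] M) →ₗ[K] P →ₗ[R] N) := by
  intro h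
  refine ⟨fun hh => ⟨(LinearEquiv.ofInjective f hf).symm.toLinearMap ∘ₗ
    h.codRestrict (LinearMap.range f) fun x => (hfg _).1 (DFunLike.congr_fun hh x), ?_⟩, ?_⟩
  · ext x
    exact congrArg Subtype.val ((LinearEquiv.ofInjective f hf).apply_symm_apply _)
  · rintro ⟨k, rfl⟩
    exact LinearMap.ext fun x => hfg.apply_apply_eq_zero (k x)

instance finite_hom [Module.Finite K M] [Module K N] [IsScalarTower K R N] [Module.Finite K N] :
    Module.Finite K (M →ₗ[R] N) :=
  .of_injective (LinearMap.restrictScalarsₗ K R M N K) (LinearMap.restrictScalars_injective K)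

instance finite_submodule [Module.Finite K M] (p : Submodule R M) : Module.Finite K p :=
  .of_injective (p.subtype.restrictScalars K) p.injective_subtype

variable [Module K P] [IsScalarTower K R P] [Module.Finite K P]

theorem finrank_hom_of_projective [Module K N] [IsScalarTower K R N] [Projective R P]
    [Module.Finite K M] {f : L →ₗ[R] M} {g : M →ₗ[R] N} (hf : Function.Injective f)
    (hfg : Function.Exact f g) (hg : Function.Surjective g) :
    finrank K (P →ₗ[R] M) = finrank K (P →ₗ[R] L) + finrank K (P →ₗ[R] N) :=
  finrank_eq_add_of_exact hf.injective_linearMapComp_left (exact_compRight hf hfg)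
    fun h => projective_lifting_property g h hg

variable [Module K Q] [IsScalarTower K R Q] [Module.Finite K Q]

theorem finrank_hom_add_finrank_hom [Projective R P] (hQ : Module.Baer R Q)
    {i : N →ₗ[R] P} {p : P →ₗ[R] S} (hi : Function.Injective i) (hip : Function.Exact i p)
    (hp : Function.Surjective p) {j : L →ₗ[R] Q} {q : Q →ₗ[R] M} (hj : Function.Injective j)
    (hjq : Function.Exact j q) (hq : Function.Surjective q) :
    finrank K (P →ₗ[R] L) + finrank K (S →ₗ[R] M) =
      finrank K (S →ₗ[R] Q) + finrank K (N →ₗ[R] L) := by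
  let a : (P →ₗ[R] Q) →ₗ[K] P →ₗ[R] M := .compRight K q
  let b : (P →ₗ[R] Q) →ₗ[K] N →ₗ[R] Q := .lcomp K Q i
  have hab : LinearMap.lcomp K M i ∘ₗ a = LinearMap.compRight K q ∘ₗ b := rfl
  have ha : Function.Surjective a := fun h => projective_lifting_property q h hq
  have hb : Function.Surjective b := surjective_lcomp_of_injective hQ hi
  have h := congrArg (fun f => finrank K (LinearMap.ker f)) hab
  simp only [finrank_ker_comp_of_surjective _ ha, finrank_ker_comp_of_surjective _ hb] at h
  rwa [finrank_ker_of_exact hj.injective_linearMapComp_left (exact_compRight hj hjq),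
    finrank_ker_of_exact (LinearMap.lcomp_injective_of_surjective p hp) (exact_lcomp hip hp),
    finrank_ker_of_exact (LinearMap.lcomp_injective_of_surjective p hp) (exact_lcomp hip hp),
    finrank_ker_of_exact hj.injective_linearMapComp_left (exact_compRight hj hjq)] at h

theorem finrank_pi_hom {n : ℕ} (X : Fin n → Type*) [∀ k, AddCommGroup (X k)] [∀ k, Module R (X k)]
    [∀ k, Module K (X k)] [∀ k, IsScalarTower K R (X k)] [∀ k, Module.Finite K (X k)]
    [Module.Finite K M] :
    finrank K ((Π k, X k) →ₗ[R] M) = ∑ k, finrank K (X k →ₗ[R] M) := by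
  rw [← (LinearMap.lsum R X K (M := M)).finrank_eq, finrank_pi_fintype]

theorem finrank_hom_pi {n : ℕ} (X : Fin n → Type*) [∀ k, AddCommGroup (X k)] [∀ k, Module R (X k)]
    [∀ k, Module K (X k)] [∀ k, IsScalarTower K R (X k)] [∀ k, Module.Finite K (X k)]
    [Module.Finite K M] :
    finrank K (M →ₗ[R] Π k, X k) = ∑ k, finrank K (M →ₗ[R] X k) := by
  let e : (M →ₗ[R] Π k, X k) ≃ₗ[K] Π k, M →ₗ[R] X k :=
    { toFun f k := .proj k ∘ₗ f
      invFun := LinearMap.pi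
      map_add' _ _ := rfl
      map_smul' _ _ := rfl
      left_inv _ := rfl
      right_inv _ := rfl }
  rw [e.finrank_eq, finrank_pi_fintype]

end HomDimension

/-- A complete family of orthogonal idempotents of a `K`-algebra `R` exhibiting it as a split basic
algebra: `χ i` is the character through which `R` acts on the simple top of `R e i`. -/
structure BasicIdempotents (K R ι : Type*) [Field K] [Ring R] [Algebra K R] [Fintype ι] where
  e : ι → R
  complete : CompleteOrthogonalIdempotents e
  χ : ι → R →ₐ[K] K
  χ_e_self : ∀ i, χ i (e i) = 1
  mem_jacobson : ∀ r, (∀ i, χ i r = 0) → r ∈ Ring.jacobson R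

namespace BasicIdempotents

variable {K R ι : Type*} [Field K] [Ring R] [Algebra K R] [Fintype ι] (S : BasicIdempotents K R ι)

theorem e_mul_self (i : ι) : S.e i * S.e i = S.e i :=
  S.complete.idem i

theorem χ_e_of_ne {i j : ι} (hij : i ≠ j) : S.χ i (S.e j) = 0 := by
  have h := congrArg (S.χ i) (S.complete.ortho hij)
  rwa [map_mul, S.χ_e_self, one_mul, map_zero] at h

/-- The simple `R`-module at `i`: the field `K` with `R` acting through the character `χ i`. -/
def Simple (_S : BasicIdempotents K R ι) (_i : ι) : Type _ := K

instance (i : ι) : AddCommGroup (S.Simple i) := inferInstanceAs (AddCommGroup K)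
instance (i : ι) : Module K (S.Simple i) := inferInstanceAs (Module K K)
instance (i : ι) : Module R (S.Simple i) := Module.compHom K (S.χ i).toRingHom
instance (i : ι) : Module.Finite K (S.Simple i) := inferInstanceAs (Module.Finite K K)

theorem smul_simple {i : ι} (r : R) (s : S.Simple i) : r • s = S.χ i r • s := rfl

instance (i : ι) : IsScalarTower K R (S.Simple i) :=
  ⟨fun k r s => by simp only [smul_simple, map_smul, smul_assoc]⟩

theorem finrank_simple (i : ι) : finrank K (S.Simple i) = 1 :=
  finrank_self K

instance (i : ι) : IsSimpleModule R (S.Simple i) :=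
  isSimpleModule_iff R _ |>.2 (is_simple_module_of_finrank_eq_one (S.finrank_simple i))

/-- The projective `R`-module `R e i`. -/
def proj (i : ι) : Ideal R := Ideal.span {S.e i}

theorem mul_e_of_mem_proj {i : ι} {x : R} (hx : x ∈ S.proj i) : x * S.e i = x := by
  obtain ⟨r, rfl⟩ := Ideal.mem_span_singleton'.1 hx
  rw [mul_assoc, S.e_mul_self]

/-- The idempotent `e i` as an element of `R e i`. -/
def gen (i : ι) : S.proj i := ⟨S.e i, Ideal.mem_span_singleton_self _⟩

theorem smul_gen {i : ι} (x : S.proj i) : (x : R) • S.gen i = x :=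
  Subtype.ext (S.mul_e_of_mem_proj x.2)

theorem e_smul_gen (i : ι) : S.e i • S.gen i = S.gen i := S.smul_gen (S.gen i)

instance (i : ι) : Module.Projective R (S.proj i) :=
  .of_split (S.proj i).subtype (LinearMap.toSpanSingleton R _ (S.gen i)) (LinearMap.ext S.smul_gen)

instance (i : ι) : Module.Finite R (S.proj i) :=
  .of_surjective (LinearMap.toSpanSingleton R _ (S.gen i)) fun x => ⟨x, S.smul_gen x⟩

variable {M N X : Type*} [AddCommGroup M] [Module R M] [AddCommGroup N] [Module R N]
  [AddCommGroup X] [Module R X]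

theorem e_smul_apply_gen {i : ι} (u : S.proj i →ₗ[R] M) : S.e i • u (S.gen i) = u (S.gen i) := by
  rw [← map_smul, S.e_smul_gen]

variable {S} in
theorem hom_proj_ext {i : ι} {u v : S.proj i →ₗ[R] M} (h : u (S.gen i) = v (S.gen i)) : u = v := by
  ext x
  rw [← S.smul_gen x, map_smul, map_smul, h]

/-- The homomorphism `R e i → M` given by an element of `M`. -/
def projHom (i : ι) (m : M) : S.proj i →ₗ[R] M :=
  LinearMap.toSpanSingleton R M m ∘ₗ (S.proj i).subtype

/-- The generator `1` of the simple module at `i`. -/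
def simpleGen (i : ι) : S.Simple i := (1 : K)

theorem simpleGen_ne_zero (i : ι) : S.simpleGen i ≠ 0 := one_ne_zero (α := K)

theorem e_smul_simpleGen (i : ι) : S.e i • S.simpleGen i = S.simpleGen i := by
  rw [smul_simple, S.χ_e_self, one_smul]

/-- The projection of `R e i` onto its simple top. -/
def top (i : ι) : S.proj i →ₗ[R] S.Simple i := S.projHom i (S.simpleGen i)

theorem top_apply {i : ι} (x : S.proj i) : S.top i x = S.χ i x • S.simpleGen i := rfl

theorem top_ne_zero (i : ι) : S.top i ≠ 0 := fun h =>
  S.simpleGen_ne_zero i <| by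
    simpa only [top_apply, gen, S.χ_e_self, one_smul, LinearMap.zero_apply]
      using LinearMap.congr_fun h (S.gen i)

theorem surjective_top (i : ι) : Function.Surjective (S.top i) :=
  LinearMap.surjective_of_ne_zero (S.top_ne_zero i)

theorem finrank_hom_simple_of_generator [DecidableEq ι] {i : ι} {g : N} (hg : S.e i • g = g)
    (hspan : ∀ x : N, ∃ r : R, r • g = x) {t : N →ₗ[R] S.Simple i} (ht : t ≠ 0) (j : ι) :
    finrank K (N →ₗ[R] S.Simple j) = if i = j then 1 else 0 := by
  have ext_gen {k : ι} {u v : N →ₗ[R] S.Simple k} (h : u g = v g) : u = v := by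
    ext x
    obtain ⟨r, rfl⟩ := hspan x
    rw [map_smul, map_smul, h]
  split_ifs with hij
  · subst hij
    have htg : t g ≠ 0 := fun h => ht (ext_gen h)
    refine finrank_eq_one t ht fun u => ?_
    obtain ⟨c, hc⟩ := exists_smul_eq_of_finrank_eq_one (S.finrank_simple i) htg (u g)
    exact ⟨c, ext_gen hc⟩
  · have : Subsingleton (N →ₗ[R] S.Simple j) := subsingleton_of_forall_eq 0 fun u => ext_gen <| by
      rw [← hg, map_smul, smul_simple, S.χ_e_of_ne (Ne.symm hij), zero_smul, LinearMap.zero_apply]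
    exact finrank_zero_of_subsingleton

theorem finrank_hom_proj_simple [DecidableEq ι] (i j : ι) :
    finrank K (S.proj i →ₗ[R] S.Simple j) = if i = j then 1 else 0 :=
  S.finrank_hom_simple_of_generator (S.e_smul_gen i) (fun x => ⟨x, S.smul_gen x⟩)
    (S.top_ne_zero i) j

theorem finrank_hom_simple_simple [DecidableEq ι] (i j : ι) :
    finrank K (S.Simple i →ₗ[R] S.Simple j) = if i = j then 1 else 0 :=
  S.finrank_hom_simple_of_generator (S.e_smul_simpleGen i)
    (IsSimpleModule.toSpanSingleton_surjective R (S.simpleGen_ne_zero i))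
    (t := LinearMap.id)
    (fun h => S.simpleGen_ne_zero i (LinearMap.congr_fun h (S.simpleGen i))) j

theorem exists_equiv_simple (T : Type*) [AddCommGroup T] [Module R T] [IsSimpleModule R T] :
    ∃ i, Nonempty (S.Simple i ≃ₗ[R] T) := by
  have := IsSimpleModule.nontrivial R T
  obtain ⟨t, ht⟩ := exists_ne (0 : T)
  obtain ⟨i, hi⟩ : ∃ i, S.e i • t ≠ 0 := by
    by_contra! h
    rw [← one_smul R t, ← S.complete.complete, Finset.sum_smul] at ht
    exact ht (Finset.sum_eq_zero fun i _ => h i)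
  have hsmul (r : R) : r • S.e i • t = algebraMap K R (S.χ i r) • S.e i • t := by
    rw [← sub_eq_zero, ← sub_smul, ← mul_smul]
    refine Module.mem_annihilator.1 (IsSemisimpleModule.jacobson_le_annihilator R T
      (S.mem_jacobson _ fun j => ?_)) t
    rcases eq_or_ne j i with rfl | hji
    · simp
    · simp [S.χ_e_of_ne hji]
  let f : S.Simple i →ₗ[R] T :=
    { toFun (s : K) := algebraMap K R s • S.e i • t
      map_add' (s s' : K) := by rw [← add_smul, ← map_add]; rfl
      map_smul' r (s : K) := calc
        algebraMap K R (S.χ i r * s) • S.e i • t = algebraMap K R s • r • S.e i • t := by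
          rw [hsmul r, mul_comm, map_mul, mul_smul]
        _ = r • algebraMap K R s • S.e i • t := by
          rw [← mul_smul, Algebra.commutes, mul_smul] }
  have hf : f ≠ 0 := fun h => hi <| calc
    S.e i • t = algebraMap K R 1 • S.e i • t := by rw [map_one, one_smul]
    _ = 0 := LinearMap.congr_fun h (S.simpleGen i)
  exact ⟨i, ⟨.ofBijective f (LinearMap.bijective_of_ne_zero hf)⟩⟩

theorem exists_hom_simple_ne_zero [Module.Finite R M] [Nontrivial M] :
    ∃ (i : ι) (u : M →ₗ[R] S.Simple i), u ≠ 0 := by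
  obtain ⟨N, hN, -⟩ := (eq_top_or_exists_le_coatom (⊥ : Submodule R M)).resolve_left bot_ne_top
  have : IsSimpleModule R (M ⧸ N) := isSimpleModule_iff_isCoatom.2 hN
  obtain ⟨i, ⟨e⟩⟩ := S.exists_equiv_simple (M ⧸ N)
  exact ⟨i, e.symm.toLinearMap ∘ₗ N.mkQ, fun h => hN.1 <| by simpa using congrArg LinearMap.ker h⟩

/-- The homomorphism `f : M → N` is radical if its image lies in the radical of `N`, the common
kernel of the homomorphisms from `N` to the simple modules. -/
def IsRadicalHom (f : M →ₗ[R] N) : Prop :=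
  ∀ (i : ι) (u : N →ₗ[R] S.Simple i), u ∘ₗ f = 0

theorem isRadicalHom_iff [Module.Finite R N] (f : M →ₗ[R] N) :
    S.IsRadicalHom f ↔ ∀ L : Submodule R N, L ⊔ LinearMap.range f = ⊤ → L = ⊤ := by
  constructor
  · intro hf L hL
    by_contra hne
    have : Nontrivial (N ⧸ L) := Submodule.Quotient.nontrivial_iff.2 hne
    obtain ⟨i, u, hu⟩ := S.exists_hom_simple_ne_zero (M := N ⧸ L)
    refine hu (L.linearMap_qext (LinearMap.ker_eq_top.1 (top_le_iff.1
      (hL.symm.trans_le (sup_le ?_ ?_)))))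
    · exact L.ker_mkQ.symm.trans_le (LinearMap.ker_le_ker_comp _ _)
    · exact LinearMap.range_le_ker_iff.2 (hf i _)
  · intro hf i u
    rcases (LinearMap.surjective_or_eq_zero u) with hu | rfl
    · have hcoatom := LinearMap.isCoatom_ker_of_surjective hu
      by_contra hne
      exact hcoatom.1 (hf _ (hcoatom.2 _
        (left_lt_sup.2 fun h => hne (LinearMap.range_le_ker_iff.1 h))))
    · rw [LinearMap.zero_comp]

section RadicalExact

variable [Module K X] [IsScalarTower K R X] [Module.Finite K X] [Module K N] [IsScalarTower K R N]
  [Module.Finite K N]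

theorem isRadicalHom_iff_finrank_hom_simple_eq {f : M →ₗ[R] X} {g : X →ₗ[R] N}
    (hfg : Function.Exact f g) (hg : Function.Surjective g) :
    S.IsRadicalHom f ↔
      ∀ i, finrank K (X →ₗ[R] S.Simple i) = finrank K (N →ₗ[R] S.Simple i) := by
  refine forall_congr' fun i => ?_
  have hinj : Function.Injective (LinearMap.lcomp K (S.Simple i) g) :=
    LinearMap.lcomp_injective_of_surjective g hg
  have hexact := exact_lcomp (K := K) (Q := S.Simple i) hfg hg
  constructor
  · intro h
    refine (LinearEquiv.ofBijective (LinearMap.lcomp K (S.Simple i) g)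
      ⟨hinj, fun u => (hexact u).1 (h u)⟩).finrank_eq.symm
  · intro h u
    exact (hexact u).2 ((LinearMap.injective_iff_surjective_of_finrank_eq_finrank h.symm).1 hinj u)

end RadicalExact

theorem isRadicalHom_ker_top [Module.Finite K R] (i : ι) :
    S.IsRadicalHom (LinearMap.ker (S.top i)).subtype := by
  classical
  have : Module.Finite K (S.proj i) := .trans R _
  rw [S.isRadicalHom_iff_finrank_hom_simple_eq (LinearMap.exact_subtype_ker_map _)
    (S.surjective_top i)]
  intro j
  rw [finrank_hom_proj_simple, finrank_hom_simple_simple]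

theorem exists_surjective_proj [Module.Finite K R] [Module.Finite R X] [Projective R X]
    [Nontrivial X] : ∃ (i : ι) (f : X →ₗ[R] S.proj i), Function.Surjective f := by
  obtain ⟨i, u, hu⟩ := S.exists_hom_simple_ne_zero (M := X)
  obtain ⟨f, hf⟩ := projective_lifting_property (S.top i) u (S.surjective_top i)
  refine ⟨i, f, LinearMap.range_eq_top.1 ((S.isRadicalHom_iff _).1 (S.isRadicalHom_ker_top i) _ ?_)⟩
  rw [Submodule.range_subtype, ← Submodule.comap_map_eq, ← LinearMap.range_comp, hf,
    LinearMap.range_eq_top.2 (LinearMap.surjective_of_ne_zero hu), Submodule.comap_top]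

theorem exists_equiv_pi_proj [Module.Finite K R] (X : Type*) [AddCommGroup X] [Module R X]
    [Module K X] [IsScalarTower K R X] [Module.Finite K X] [Projective R X] :
    ∃ (n : ℕ) (c : Fin n → ι), Nonempty (X ≃ₗ[R] Π k, S.proj (c k)) := by
  induction h : finrank K X using Nat.strong_induction_on generalizing X with
  | _ m ih =>
  rcases subsingleton_or_nontrivial X with hX | hX
  · exact ⟨0, Fin.elim0, ⟨0, 0, fun _ => Subsingleton.elim _ _, fun _ => Subsingleton.elim _ _⟩⟩
  have : Module.Finite R X := .of_restrictScalars_finite K R X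
  obtain ⟨i, f, hf⟩ := S.exists_surjective_proj (X := X)
  obtain ⟨s, hs⟩ := projective_lifting_property f .id hf
  let e := lequivProdOfRightSplitExact (LinearMap.ker f).injective_subtype
    (Submodule.range_subtype _) hs
  have : Projective R (LinearMap.ker f) := .of_split (e.toLinearMap ∘ₗ .inl R _ _)
    (.fst R _ _ ∘ₗ e.symm.toLinearMap) (by ext; simp)
  have hf₀ : f ≠ 0 := fun h => S.top_ne_zero i <| (LinearMap.cancel_right hf).1 <| by
    rw [h, LinearMap.comp_zero, LinearMap.zero_comp]
  have hlt : finrank K (LinearMap.ker f) < m := by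
    rw [← h]
    exact Submodule.finrank_lt (s := (LinearMap.ker f).restrictScalars K) fun htop =>
      hf₀ (LinearMap.ker_eq_top.1 (Submodule.restrictScalars_injective K R X htop))
  obtain ⟨n, c, ⟨e'⟩⟩ := ih _ hlt (LinearMap.ker f) rfl
  let cons : (S.proj i × Π k, S.proj (c k)) ≃ₗ[R]
      Π k, S.proj ((Fin.cons i c : Fin (n + 1) → ι) k) :=
    Fin.consLinearEquiv R fun k => S.proj ((Fin.cons i c : Fin (n + 1) → ι) k)
  exact ⟨n + 1, Fin.cons i c,
    ⟨e.symm ≪≫ₗ .prodComm R _ _ ≪≫ₗ (LinearEquiv.refl R _).prodCongr e' ≪≫ₗ cons⟩⟩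

end BasicIdempotents

/-! ### Symmetric algebras -/

theorem baer_of_projective {R X : Type*} [Ring R] (hR : Module.Baer R R) [AddCommGroup X]
    [Module R X] [Module.Finite R X] [Projective R X] : Module.Baer R X := by
  obtain ⟨n, f, s, -, -, hfs⟩ := Module.Finite.exists_comp_eq_id_of_projective R X
  intro I g
  choose g' hg' using fun k => hR I (.proj k ∘ₗ s ∘ₗ g)
  refine ⟨f ∘ₗ .pi g', fun x hx => ?_⟩
  rw [LinearMap.comp_apply, show LinearMap.pi g' x = s (g ⟨x, hx⟩) from funext fun k => hg' k x hx]
  exact LinearMap.congr_fun hfs _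

namespace IsSymmetricKAlgebra

section Form

variable {K R : Type*} [Field K] [Ring R] [Algebra K R] {B : R →ₗ[K] R →ₗ[K] K}
  {M : Type*} [AddCommGroup M] [Module R M]

theorem eq_zero_of_forall_form_eq_zero (hassoc : ∀ a b c, B (a * b) c = B a (b * c))
    (hsymm : ∀ a b, B a b = B b a) (hB : ∀ a, (∀ b, B a b = 0) → a = 0) {f : M →ₗ[R] R}
    (hf : ∀ m, B (f m) 1 = 0) : f = 0 :=
  LinearMap.ext fun m => hB _ fun r => by
    rw [hsymm, ← mul_one (f m), ← hassoc, ← smul_eq_mul, ← map_smul, hf]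

theorem exists_linearMap_form_eq [Module K M] [IsScalarTower K R M] [Module.Finite K R]
    (hassoc : ∀ a b c, B (a * b) c = B a (b * c))
    (hsymm : ∀ a b, B a b = B b a) (hB : ∀ a, (∀ b, B a b = 0) → a = 0) (ψ : M →ₗ[K] K) :
    ∃ f : M →ₗ[R] R, ∀ m, B (f m) 1 = ψ m := by
  have hinj : Function.Injective B :=
    (injective_iff_map_eq_zero B).2 fun a ha => hB a fun b => by rw [ha, LinearMap.zero_apply]
  have hsurj : Function.Surjective B :=
    (LinearMap.injective_iff_surjective_of_finrank_eq_finrank Subspace.dual_finrank_eq.symm).1 hinj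
  choose f hf using fun m => hsurj (ψ ∘ₗ (LinearMap.toSpanSingleton R M m).restrictScalars K)
  have hf' (m : M) (r : R) : B (f m) r = ψ (r • m) := LinearMap.congr_fun (hf m) r
  refine ⟨{ toFun := f, map_add' := fun m m' => hinj ?_, map_smul' := fun a m => hinj ?_ },
    fun m => (hf' m 1).trans (by rw [one_smul])⟩
  · ext r
    rw [map_add, LinearMap.add_apply, hf', hf', hf', smul_add, map_add]
  · ext r
    rw [RingHom.id_apply, smul_eq_mul, hsymm (a * f m), ← hassoc, hsymm _ (f m), hf', hf', mul_smul]

end Form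

variable {K : Type w} {R : Type u} [Field K] [Ring R] [Algebra K R] [Module.Finite K R]

theorem baer_self (hR : IsSymmetricKAlgebra K R) : Module.Baer R R := by
  obtain ⟨B, hsymm, hassoc, hB⟩ := hR
  intro I g
  obtain ⟨ψ, hψ⟩ := (B.flip 1 ∘ₗ g.restrictScalars K).exists_extend (p := I.restrictScalars K)
  obtain ⟨f, hf⟩ := exists_linearMap_form_eq hassoc hsymm hB ψ
  have hfg : f ∘ₗ I.subtype - g = 0 := by
    refine eq_zero_of_forall_form_eq_zero hassoc hsymm hB fun x => ?_
    rw [LinearMap.sub_apply, map_sub, LinearMap.sub_apply, sub_eq_zero]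
    exact (hf _).trans (LinearMap.congr_fun hψ x)
  exact ⟨f, fun x hx => LinearMap.congr_fun (sub_eq_zero.1 hfg) ⟨x, hx⟩⟩

end IsSymmetricKAlgebra

namespace BasicIdempotents

open IsSymmetricKAlgebra

variable {K : Type w} {R : Type u} {ι : Type*} [Field K] [Ring R] [Algebra K R] [Fintype ι]
  (S : BasicIdempotents K R ι) [Module.Finite K R]
  {M X : Type*} [AddCommGroup M] [Module R M] [Module K M] [IsScalarTower K R M] [Module.Finite K M]
  [AddCommGroup X] [Module R X] [Module K X] [IsScalarTower K R X] [Module.Finite K X]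

instance (i : ι) : Module.Finite K (S.proj i) := .trans R _

theorem finrank_hom_proj_comm (hR : IsSymmetricKAlgebra K R) (i : ι) :
    finrank K (M →ₗ[R] S.proj i) = finrank K (S.proj i →ₗ[R] M) := by
  obtain ⟨B, hsymm, hassoc, hB⟩ := hR
  have hcomm (a b : R) : B (a * b) 1 = B (b * a) 1 := by
    rw [hassoc, hassoc, mul_one, mul_one, hsymm]
  let p : (S.proj i →ₗ[R] M) →ₗ[K] (M →ₗ[R] S.proj i) →ₗ[K] K :=
    LinearMap.mk₂ K (fun u f => B (f (u (S.gen i))) 1) (by simp) (by simp) (by simp) (by simp)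
  have hleft : Function.Injective p := (injective_iff_map_eq_zero p).2 fun u hu => by
    refine S.hom_proj_ext ((forall_dual_apply_eq_zero_iff K _).1 fun ψ => ?_)
    obtain ⟨f, hf⟩ := exists_linearMap_form_eq hassoc hsymm hB ψ
    calc ψ (u (S.gen i)) = B (S.e i * f (u (S.gen i))) 1 := by
          rw [← hf, ← smul_eq_mul, ← map_smul, S.e_smul_apply_gen]
      _ = B (f (u (S.gen i)) * S.e i) 1 := hcomm _ _
      _ = 0 := LinearMap.congr_fun hu (LinearMap.toSpanSingleton R _ (S.gen i) ∘ₗ f)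
  have hright : Function.Injective p.flip := (injective_iff_map_eq_zero p.flip).2 fun f hf => by
    have h : (S.proj i).subtype ∘ₗ f = 0 := by
      refine eq_zero_of_forall_form_eq_zero hassoc hsymm hB fun m => ?_
      calc B (f m) 1 = B (f m * S.e i) 1 := by rw [S.mul_e_of_mem_proj (f m).2]
        _ = B (S.e i * f m) 1 := hcomm _ _
        _ = B (f (S.e i • m)) 1 := by rw [map_smul]; rfl
        _ = 0 := LinearMap.congr_fun hf (S.projHom i m)
    exact LinearMap.ext fun m => Subtype.ext (LinearMap.congr_fun h m)
  have := LinearMap.IsPerfPair.of_injective hleft hright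
  exact (finrank_of_isPerfPair p).symm

include S in
theorem finrank_hom_projective_comm (hR : IsSymmetricKAlgebra K R) [Projective R X] :
    finrank K (M →ₗ[R] X) = finrank K (X →ₗ[R] M) := by
  obtain ⟨n, c, ⟨e⟩⟩ := S.exists_equiv_pi_proj (K := K) X
  rw [finrank_hom_congr_left e, finrank_hom_congr_right e, finrank_pi_hom, finrank_hom_pi]
  exact Finset.sum_congr rfl fun k _ => S.finrank_hom_proj_comm hR (c k)

theorem finrank_hom_proj_projective (i : ι) [Projective R X] :
    finrank K (S.proj i →ₗ[R] X) =
      ∑ j, finrank K (X →ₗ[R] S.Simple j) * finrank K (S.proj i →ₗ[R] S.proj j) := by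
  classical
  obtain ⟨n, c, ⟨e⟩⟩ := S.exists_equiv_pi_proj (K := K) X
  simp_rw [finrank_hom_congr_left e, finrank_hom_congr_right e, finrank_pi_hom, finrank_hom_pi,
    finrank_hom_proj_simple, Finset.sum_mul]
  rw [Finset.sum_comm]
  simp

end BasicIdempotents

/-! ### Minimal projective resolutions -/

theorem IsProjectiveCover.finite {R : Type u} [Ring R] {P M : ModuleCat.{v} R} {π : P →ₗ[R] M}
    (hπ : IsProjectiveCover π) [Module.Finite R M] : Module.Finite R P := by
  obtain ⟨-, hsurj, hsuperfluous⟩ := hπ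
  obtain ⟨n, s, hs⟩ := Module.Finite.exists_fin (R := R) (M := M)
  choose t ht using fun k => hsurj (s k)
  have hspan : Submodule.span R (Set.range t) = ⊤ := hsuperfluous _ <| by
    rw [← Submodule.comap_map_eq, Submodule.map_span, ← Set.range_comp,
      show π ∘ t = s from funext ht, hs, Submodule.comap_top]
  exact ⟨hspan ▸ Submodule.fg_span (Set.finite_range t)⟩

namespace BasicIdempotents

variable {K R ι : Type*} [Field K] [Ring R] [Algebra K R] [Fintype ι] {S : BasicIdempotents K R ι}
  {L M X Y : Type*} [AddCommGroup L] [Module R L] [AddCommGroup M] [Module R M]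
  [AddCommGroup X] [Module R X] [AddCommGroup Y] [Module R Y]

theorem IsRadicalHom.comp {φ : X →ₗ[R] Y} (hφ : S.IsRadicalHom φ) (f : M →ₗ[R] X) :
    S.IsRadicalHom (φ ∘ₗ f) := fun i u => by
  rw [← LinearMap.comp_assoc, hφ, LinearMap.zero_comp]

theorem IsRadicalHom.comp_eq_zero [IsNoetherian R X] (hX : Module.Baer R X) {φ : X →ₗ[R] Y}
    (hφ : S.IsRadicalHom φ) {i : ι} (u : S.Simple i →ₗ[R] X) : φ ∘ₗ u = 0 := by
  refine (LinearMap.injective_or_eq_zero (φ ∘ₗ u)).resolve_left fun hinj => ?_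
  obtain ⟨w, hw⟩ := hX.extension_property (φ ∘ₗ u) hinj u
  have hψ : S.IsRadicalHom (w ∘ₗ φ) := fun j v => hφ j (v ∘ₗ w)
  have hsurj : Function.Surjective (LinearMap.id - w ∘ₗ φ : X →ₗ[R] X) := by
    refine LinearMap.range_eq_top.1 ((S.isRadicalHom_iff _).1 hψ _ (eq_top_iff.2 fun x _ => ?_))
    rw [← sub_add_cancel x (w (φ x))]
    exact Submodule.add_mem_sup (LinearMap.mem_range_self (LinearMap.id - w ∘ₗ φ) x)
      (LinearMap.mem_range_self (w ∘ₗ φ) x)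
  have hu : u = 0 := by
    rw [← LinearMap.cancel_left
      (IsNoetherian.injective_of_surjective_endomorphism _ hsurj), LinearMap.sub_comp,
      LinearMap.comp_assoc, hw, LinearMap.id_comp, sub_self, LinearMap.comp_zero]
  rw [hu, LinearMap.comp_zero] at hinj
  exact S.simpleGen_ne_zero i (hinj rfl)

variable (S) in
/-- A short exact sequence `0 → L → X → M → 0` exhibiting `X` as a finitely generated projective
cover of `M`, the minimality being expressed by the radicality of `L → X`. -/
structure IsMinimalCover (f : L →ₗ[R] X) (g : X →ₗ[R] M) : Prop where
  injective : Function.Injective f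
  exact : Function.Exact f g
  surjective : Function.Surjective g
  projective : Projective R X
  finite : Module.Finite R X
  radical : S.IsRadicalHom f

namespace IsMinimalCover

variable {f : L →ₗ[R] X} {g : X →ₗ[R] M} (h : S.IsMinimalCover f g)

include h

theorem comp_equiv_left (e : Y ≃ₗ[R] L) : S.IsMinimalCover (f ∘ₗ e.toLinearMap) g where
  injective := h.injective.comp e.injective
  exact := by
    rw [LinearMap.exact_iff, LinearEquiv.range_comp, h.exact.linearMap_ker_eq]
  surjective := h.surjective
  projective := h.projective
  finite := h.finite
  radical := h.radical.comp e.toLinearMap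

theorem comp_equiv_right (e : M ≃ₗ[R] Y) : S.IsMinimalCover f (e.toLinearMap ∘ₗ g) where
  injective := h.injective
  exact x := by
    rw [← h.exact x]
    exact e.map_eq_zero_iff
  surjective := e.surjective.comp h.surjective
  projective := h.projective
  finite := h.finite
  radical := h.radical

theorem finite_left [IsNoetherianRing R] : Module.Finite R L :=
  have := h.finite
  .of_injective f h.injective

variable [Module.Finite K R] [Module K X] [IsScalarTower K R X]

theorem finiteDimensional : Module.Finite K X :=
  have := h.finite
  .trans R X

variable [Module K M] [IsScalarTower K R M]

theorem finrank_hom_simple (i : ι) :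
    finrank K (X →ₗ[R] S.Simple i) = finrank K (M →ₗ[R] S.Simple i) := by
  have := h.finiteDimensional (K := K)
  have : Module.Finite K M := .of_surjective (g.restrictScalars K) h.surjective
  exact (S.isRadicalHom_iff_finrank_hom_simple_eq h.exact h.surjective).1 h.radical i

variable [Module K L] [IsScalarTower K R L]

theorem finrank_simple_hom (hX : Module.Baer R X) {φ : M →ₗ[R] Y} (hφ : S.IsRadicalHom φ)
    (hφ_inj : Function.Injective φ) (i : ι) :
    finrank K (S.Simple i →ₗ[R] X) = finrank K (S.Simple i →ₗ[R] L) := by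
  have := h.finite
  have : IsNoetherian R R := isNoetherian_of_tower K inferInstance
  refine (LinearEquiv.ofBijective (LinearMap.compRight K f)
    ⟨h.injective.injective_linearMapComp_left, fun u => ?_⟩).finrank_eq.symm
  refine (exact_compRight (K := K) h.injective h.exact u).1 ((LinearMap.cancel_left hφ_inj).1 ?_)
  exact ((hφ.comp g).comp_eq_zero hX u).trans (LinearMap.comp_zero φ).symm

end IsMinimalCover

theorem isMinimalCover_top [Module.Finite K R] (i : ι) :
    S.IsMinimalCover (LinearMap.ker (S.top i)).subtype (S.top i) := by
  classical exact
  { injective := Submodule.injective_subtype _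
    exact := LinearMap.exact_subtype_ker_map _
    surjective := S.surjective_top i
    projective := inferInstance
    finite := inferInstance
    radical := S.isRadicalHom_ker_top i }

theorem finrank_hom_simple_le [Module.Finite K R] [Module K M] [IsScalarTower K R M]
    [Module.Finite K M] (i : ι) :
    finrank K (M →ₗ[R] S.Simple i) ≤ finrank K (S.proj i →ₗ[R] M) := by
  let p : (M →ₗ[R] S.Simple i) →ₗ[K] (S.proj i →ₗ[R] M) →ₗ[K] K :=
    LinearMap.mk₂ K (fun v u => v (u (S.gen i))) (fun _ _ _ => rfl) (fun _ _ _ => rfl)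
      (fun v _ _ => map_add v _ _) (fun c v u => LinearMap.map_smul_of_tower v c (u (S.gen i)))
  have hp : Function.Injective p := (injective_iff_map_eq_zero p).2 fun v hv =>
    LinearMap.ext fun m => calc
      v m = v (S.e i • m) := by rw [map_smul, S.smul_simple, S.χ_e_self, one_smul]
      _ = 0 := LinearMap.congr_fun hv (S.projHom i m)
  exact (LinearMap.finrank_le_finrank_of_injective hp).trans_eq Subspace.dual_finrank_eq

end BasicIdempotents

namespace BasicIdempotents

variable {K : Type*} {R : Type u} {ι : Type*} [Field K] [Ring R] [Algebra K R] [Fintype ι]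

theorem exists_isMinimalCover_of_isSyzygy (S : BasicIdempotents K R ι) {M L : ModuleCat.{v} R}
    (h : IsSyzygy M L) [Module.Finite R M] :
    ∃ (X : ModuleCat.{v} R) (f : L →ₗ[R] X) (g : X →ₗ[R] M), S.IsMinimalCover f g := by
  obtain ⟨X, π, hπ, ⟨e⟩⟩ := h
  have := hπ.finite
  let f := (LinearMap.ker π).subtype ∘ₗ e.toLinearMap
  have hf : LinearMap.range f = LinearMap.ker π := by
    rw [LinearEquiv.range_comp, Submodule.range_subtype]
  exact ⟨X, f, π, Subtype.val_injective.comp e.injective, LinearMap.exact_iff.2 hf.symm, hπ.2.1,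
    hπ.1, this, (S.isRadicalHom_iff f).2 fun N => by rw [hf]; exact hπ.2.2 N⟩

/-- The dimension of `Ext¹(S a, S b)` for the simple modules `S a` and `S b`, computed by the
projective cover of `S a`. -/
def extDim (S : BasicIdempotents K R ι) (a b : ι) : ℕ :=
  finrank K (LinearMap.ker (S.top a) →ₗ[R] S.Simple b)

/-- The Cartan number `dim e a R e b`. -/
def cartan (S : BasicIdempotents K R ι) (a b : ι) : ℕ :=
  finrank K (S.proj a →ₗ[R] S.proj b)

/-- A minimal projective resolution of the simple module at `a` whose fourth syzygy is again the
simple module at `a`; `M k` are the intermediate syzygies. -/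
structure PeriodicResolution (S : BasicIdempotents K R ι) (a : ι) where
  (X₀ X₁ X₂ X₃ M₁ M₂ M₃ : ModuleCat.{v} R)
  f₀ : M₁ →ₗ[R] X₀
  g₀ : X₀ →ₗ[R] S.Simple a
  f₁ : M₂ →ₗ[R] X₁
  g₁ : X₁ →ₗ[R] M₁
  f₂ : M₃ →ₗ[R] X₂
  g₂ : X₂ →ₗ[R] M₂
  f₃ : S.Simple a →ₗ[R] X₃
  g₃ : X₃ →ₗ[R] M₃
  cover₀ : S.IsMinimalCover f₀ g₀
  cover₁ : S.IsMinimalCover f₁ g₁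
  cover₂ : S.IsMinimalCover f₂ g₂
  cover₃ : S.IsMinimalCover f₃ g₃

theorem nonempty_periodicResolution [IsNoetherianRing R] (S : BasicIdempotents K R ι) {a : ι}
    {T : ModuleCat.{v} R} (hT : IsNthSyzygy 4 T T) (e : T ≃ₗ[R] S.Simple a) :
    Nonempty (PeriodicResolution.{u, v} S a) := by
  obtain ⟨M₁, h₀, M₂, h₁, M₃, h₂, M₄, h₃, ⟨e'⟩⟩ := hT
  have : IsSimpleModule R T := .congr e
  obtain ⟨X₀, f₀, g₀, c₀⟩ := S.exists_isMinimalCover_of_isSyzygy h₀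
  have := c₀.finite_left
  obtain ⟨X₁, f₁, g₁, c₁⟩ := S.exists_isMinimalCover_of_isSyzygy h₁
  have := c₁.finite_left
  obtain ⟨X₂, f₂, g₂, c₂⟩ := S.exists_isMinimalCover_of_isSyzygy h₂
  have := c₂.finite_left
  obtain ⟨X₃, f₃, g₃, c₃⟩ := S.exists_isMinimalCover_of_isSyzygy h₃
  exact ⟨⟨X₀, X₁, X₂, X₃, M₁, M₂, M₃, f₀, _, f₁, g₁, f₂, g₂, _, g₃, c₀.comp_equiv_right e, c₁, c₂,
    c₃.comp_equiv_left (e.symm ≪≫ₗ e')⟩⟩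

theorem IsMinimalCover.finrank_hom_proj_add {S : BasicIdempotents K R ι} [Module.Finite K R]
    {L M X : Type*} [AddCommGroup L] [Module R L] [AddCommGroup M] [Module R M]
    [AddCommGroup X] [Module R X] [Module K L] [IsScalarTower K R L] [Module K M]
    [IsScalarTower K R M] [Module K X] [IsScalarTower K R X] {f : L →ₗ[R] X} {g : X →ₗ[R] M}
    (h : S.IsMinimalCover f g) (a : ι) :
    finrank K (S.proj a →ₗ[R] L) + finrank K (S.proj a →ₗ[R] M) =
      ∑ b, finrank K (M →ₗ[R] S.Simple b) * S.cartan a b := by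
  have := h.projective
  have := h.finiteDimensional (K := K)
  rw [← finrank_hom_of_projective h.injective h.exact h.surjective, finrank_hom_proj_projective]
  simp only [h.finrank_hom_simple, cartan]

namespace PeriodicResolution

open scoped ModuleCat

variable {S : BasicIdempotents K R ι} {a : ι} [Module.Finite K R]
  (r : PeriodicResolution.{u, v} S a)

include r

theorem finrank_simple_hom_X₂ (hR : IsSymmetricKAlgebra K R) (b : ι) :
    finrank K (S.Simple b →ₗ[R] r.X₂) = finrank K (S.Simple b →ₗ[R] r.M₃) :=
  have := r.cover₂.finite
  have := r.cover₂.projective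
  r.cover₂.finrank_simple_hom (baer_of_projective hR.baer_self) r.cover₁.radical
    r.cover₁.injective b

theorem finrank_simple_hom_X₃ (hR : IsSymmetricKAlgebra K R) (b : ι) :
    finrank K (S.Simple b →ₗ[R] r.X₃) = finrank K (S.Simple b →ₗ[R] S.Simple a) :=
  have := r.cover₃.finite
  have := r.cover₃.projective
  r.cover₃.finrank_simple_hom (baer_of_projective hR.baer_self) r.cover₂.radical
    r.cover₂.injective b

-- Both sides compute `Ext¹(S b, S a)`: by a projective resolution of `S b`, and by the injective
-- resolution of `S a` given by reading the periodic resolution backwards.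
theorem finrank_hom_simple_of_isMinimalCover (hR : IsSymmetricKAlgebra K R) {b : ι}
    {L X : Type*} [AddCommGroup L] [Module R L] [AddCommGroup X] [Module R X] [Module K X]
    [IsScalarTower K R X] {f : L →ₗ[R] X} {g : X →ₗ[R] S.Simple b} (h : S.IsMinimalCover f g) :
    finrank K (L →ₗ[R] S.Simple a) = finrank K (S.Simple b →ₗ[R] r.M₃) := by
  have := h.finite
  have := h.projective
  have := r.cover₃.finite
  have := r.cover₃.projective
  have := h.finiteDimensional (K := K)
  have := r.cover₃.finiteDimensional (K := K)
  have key := finrank_hom_add_finrank_hom (K := K) (baer_of_projective hR.baer_self) h.injective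
    h.exact h.surjective r.cover₃.injective r.cover₃.exact r.cover₃.surjective
  rw [h.finrank_hom_simple, r.finrank_simple_hom_X₃ hR] at key
  lia

theorem extDim_eq (hR : IsSymmetricKAlgebra K R) (b : ι) :
    S.extDim b a = finrank K (S.Simple b →ₗ[R] r.M₃) :=
  r.finrank_hom_simple_of_isMinimalCover hR (S.isMinimalCover_top b)

theorem finrank_hom_simple_X₂ (hR : IsSymmetricKAlgebra K R) (b : ι) :
    finrank K (r.X₂ →ₗ[R] S.Simple b) = S.extDim b a := by
  have := r.cover₂.projective
  have := r.cover₂.finiteDimensional (K := K)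
  rw [← S.finrank_hom_projective_comm hR, r.finrank_simple_hom_X₂ hR, r.extDim_eq hR]

theorem finrank_hom_simple_M₃ [DecidableEq ι] (hR : IsSymmetricKAlgebra K R) (b : ι) :
    finrank K (r.M₃ →ₗ[R] S.Simple b) = if b = a then 1 else 0 := by
  have := r.cover₃.projective
  have := r.cover₃.finiteDimensional (K := K)
  rw [← r.cover₃.finrank_hom_simple, ← S.finrank_hom_projective_comm hR,
    r.finrank_simple_hom_X₃ hR, finrank_hom_simple_simple]

theorem finrank_hom_simple_M₁ (hR : IsSymmetricKAlgebra K R) {b : ι}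
    (s : PeriodicResolution.{u, v} S b) :
    finrank K (r.M₁ →ₗ[R] S.Simple b) = S.extDim a b :=
  (s.finrank_hom_simple_of_isMinimalCover hR r.cover₀).trans (s.extDim_eq hR a).symm

theorem finrank_hom_proj_M₁_add [DecidableEq ι] (b : ι) :
    finrank K (S.proj b →ₗ[R] r.M₁) + (if b = a then 1 else 0) = S.cartan b a := by
  have h := r.cover₀.finrank_hom_proj_add (K := K) b
  simpa [finrank_hom_proj_simple, finrank_hom_simple_simple] using h

theorem finrank_hom_proj_M₃_add [DecidableEq ι] (hR : IsSymmetricKAlgebra K R) (b : ι) :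
    finrank K (S.proj b →ₗ[R] r.M₃) + (if b = a then 1 else 0) = S.cartan b a := by
  have h := r.cover₃.finrank_hom_proj_add (K := K) b
  simpa [finrank_hom_proj_simple, r.finrank_hom_simple_M₃ hR, add_comm] using h

theorem finrank_hom_proj_M₃_add_M₂ (hR : IsSymmetricKAlgebra K R) (b : ι) :
    finrank K (S.proj b →ₗ[R] r.M₃) + finrank K (S.proj b →ₗ[R] r.M₂) =
      ∑ c, S.extDim c a * S.cartan b c := by
  simp only [r.cover₂.finrank_hom_proj_add, ← r.cover₂.finrank_hom_simple,
    r.finrank_hom_simple_X₂ hR]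

theorem finrank_hom_proj_M₂_add_M₁ (hR : IsSymmetricKAlgebra K R)
    (s : ∀ b, PeriodicResolution.{u, v} S b) (b : ι) :
    finrank K (S.proj b →ₗ[R] r.M₂) + finrank K (S.proj b →ₗ[R] r.M₁) =
      ∑ c, S.extDim a c * S.cartan b c := by
  simp only [r.cover₁.finrank_hom_proj_add, r.finrank_hom_simple_M₁ hR (s _)]

theorem extDim_le_finrank_hom_proj_M₂ (hR : IsSymmetricKAlgebra K R) (b : ι) :
    S.extDim b a ≤ finrank K (S.proj b →ₗ[R] r.M₂) := by
  have := r.cover₂.finiteDimensional (K := K)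
  have : Module.Finite K r.M₂ := .of_surjective (r.g₂.restrictScalars K) r.cover₂.surjective
  rw [← r.finrank_hom_simple_X₂ hR, r.cover₂.finrank_hom_simple]
  exact S.finrank_hom_simple_le b

end PeriodicResolution

section Cartan

variable [Module.Finite K R] (S : BasicIdempotents K R ι) (hR : IsSymmetricKAlgebra K R)
  (hS : ∀ a, Nonempty (PeriodicResolution.{u, v} S a))

include hR hS

theorem sum_extDim_mul_cartan (a b : ι) :
    ∑ c, S.extDim a c * S.cartan b c = ∑ c, S.extDim c a * S.cartan b c := by
  classical
  have r c := (hS c).some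
  rw [← (r a).finrank_hom_proj_M₂_add_M₁ hR r, ← (r a).finrank_hom_proj_M₃_add_M₂ hR]
  have := (r a).finrank_hom_proj_M₁_add b
  have := (r a).finrank_hom_proj_M₃_add hR b
  lia

theorem cartan_add_extDim_le [DecidableEq ι] (a b : ι) :
    S.cartan b a + S.extDim b a ≤
      ∑ c, S.extDim a c * S.cartan b c + if b = a then 1 else 0 := by
  have r c := (hS c).some
  have := (r a).finrank_hom_proj_M₂_add_M₁ hR r b
  have := (r a).finrank_hom_proj_M₁_add b
  have := (r a).extDim_le_finrank_hom_proj_M₂ hR b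
  lia

end Cartan

end BasicIdempotents

/-! ### Triangles through a vertex with one arrow in and one arrow out -/

section Numerics

variable {ι : Type*} [Fintype ι]

theorem sum_mul_eq_of_sum_lt_two {n : ι → ℕ} {a : ι} (ha : n a ≠ 0) (hn : ∑ c, n c < 2)
    (f : ι → ℕ) : ∑ c, n c * f c = f a := by
  classical
  have hsum := Finset.add_sum_erase Finset.univ n (Finset.mem_univ a)
  have hzero : ∀ c ≠ a, n c = 0 := fun c hc => by
    have := Finset.single_le_sum (f := n) (fun _ _ => Nat.zero_le _)
      (Finset.mem_erase.2 ⟨hc, Finset.mem_univ c⟩)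
    lia
  rw [Finset.sum_eq_single a (fun c _ hc => by rw [hzero c hc, zero_mul]) (by simp),
    show n a = 1 by lia, one_mul]

variable [DecidableEq ι] {n p : ι → ι → ℕ}

theorem two_le_degrees_of_triangle (heq : ∀ a b, ∑ c, n a c * p b c = ∑ c, n c a * p b c)
    (hle : ∀ a b, p b a + n b a ≤ ∑ c, n a c * p b c + if b = a then 1 else 0)
    {x i j : ι} (hloop : n i i = 0) (hin : ∑ c, n i c < 2) (hout : ∑ c, n c i < 2)
    (hix : n i x ≠ 0) (hji : n j i ≠ 0) (hxj : n x j ≠ 0) :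
    (2 ≤ ∑ c, n x c ∧ 2 ≤ ∑ c, n c x) ∧ 2 ≤ ∑ c, n j c ∧ 2 ≤ ∑ c, n c j := by
  have le_sum {m : ι → ℕ} {a : ι} (ha : m a ≠ 0) (b : ι) : p b a ≤ ∑ c, m c * p b c :=
    (Nat.le_mul_of_pos_left _ (Nat.pos_of_ne_zero ha)).trans <|
      Finset.single_le_sum (f := fun c => m c * p b c) (fun _ _ => Nat.zero_le _)
        (Finset.mem_univ a)
  have hpx (b : ι) : p b x = p b j := by
    rw [← sum_mul_eq_of_sum_lt_two hix hin (p b), heq,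
      sum_mul_eq_of_sum_lt_two (n := fun c => n c i) hji hout]
  have hij : i ≠ j := by rintro rfl; exact hji hloop
  have hix' : i ≠ x := by rintro rfl; exact hix hloop
  have hlt : p j i < p j j := by
    have := hle i j
    rw [sum_mul_eq_of_sum_lt_two hix hin, hpx, if_neg hij.symm] at this
    lia
  refine ⟨⟨?_, ?_⟩, ?_, ?_⟩ <;> by_contra! h
  · have := hle x i
    rw [sum_mul_eq_of_sum_lt_two hxj h, hpx, if_neg hix'] at this
    lia
  · have := le_sum (m := n x) hxj j
    rw [heq, sum_mul_eq_of_sum_lt_two (n := fun c => n c x) hix h] at this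
    lia
  · have := le_sum (m := fun c => n c j) hxj j
    rw [← heq, sum_mul_eq_of_sum_lt_two hji h, hpx] at this
    lia
  · have := hle j x
    rw [heq, sum_mul_eq_of_sum_lt_two (n := fun c => n c j) hxj h, hpx] at this
    obtain rfl : x = j := by
      by_contra hne
      rw [if_neg hne] at this
      lia
    have := Finset.add_le_sum (f := fun c => n c x) (fun _ _ => Nat.zero_le _)
      (Finset.mem_univ i) (Finset.mem_univ x) hix'
    lia

end Numerics

/-! ### Fibers of modules over a tensor product of algebras -/

section Fibers

variable {K A C : Type*} [Field K] [Ring A] [Algebra K A] [Ring C] [Algebra K C]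

/-- The homomorphism `A ⊗ C → A` evaluating the second factor at a character of `C`. -/
def evalRight (A : Type*) [Ring A] [Algebra K A] (χ : C →ₐ[K] K) : A ⊗[K] C →ₐ[K] A :=
  (Algebra.TensorProduct.rid K K A).toAlgHom.comp (Algebra.TensorProduct.map (.id K A) χ)

theorem evalRight_tmul (χ : C →ₐ[K] K) (a : A) (c : C) : evalRight A χ (a ⊗ₜ c) = χ c • a := by
  simp [evalRight]

/-- A module over `A ⊗ C` regarded as a module over `C`. -/
def RestrictRight (K A C M : Type*) [Field K] [Ring A] [Algebra K A] [Ring C] [Algebra K C]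
    [AddCommGroup M] [Module (A ⊗[K] C) M] : Type _ := M

/-- The fiber `M ⊗_C K` at a character of `C` of a module `M` over `A ⊗ C`. -/
def Fiber (A : Type*) [Ring A] [Algebra K A] (χ : C →ₐ[K] K) (M : Type*) [AddCommGroup M]
    [Module (A ⊗[K] C) M] : Type _ :=
  M ⧸ (RingHom.ker (evalRight A χ) • ⊤ : Submodule (A ⊗[K] C) M)

variable {χ : C →ₐ[K] K} {L M N P : Type*} [AddCommGroup L] [Module (A ⊗[K] C) L] [AddCommGroup M]
  [Module (A ⊗[K] C) M] [AddCommGroup N] [Module (A ⊗[K] C) N]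
  [AddCommGroup P] [Module (A ⊗[K] C) P]

namespace RestrictRight

instance : AddCommGroup (RestrictRight K A C M) := inferInstanceAs (AddCommGroup M)

instance : Module C (RestrictRight K A C M) :=
  Module.compHom M (Algebra.TensorProduct.includeRight : C →ₐ[K] A ⊗[K] C).toRingHom

/-- A homomorphism of `A ⊗ C`-modules regarded as a homomorphism of `C`-modules. -/
def map (f : M →ₗ[A ⊗[K] C] N) : RestrictRight K A C M →ₗ[C] RestrictRight K A C N where
  toFun := f
  map_add' := map_add f
  map_smul' c := map_smul f ((1 : A) ⊗ₜ[K] c)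

theorem free_tensorProduct : Module.Free C (RestrictRight K A C (A ⊗[K] C)) := by
  let σ := TensorProduct.comm K C A
  have hσ (c : C) (t : C ⊗[K] A) : σ (c • t) = ((1 : A) ⊗ₜ[K] c) * σ t := by
    induction t using TensorProduct.induction_on with
    | zero => rw [smul_zero, map_zero, mul_zero]
    | add s t hs ht => rw [smul_add, map_add, hs, ht, map_add, mul_add]
    | tmul y x =>
      simp only [σ, TensorProduct.smul_tmul', TensorProduct.comm_tmul, smul_eq_mul,
        Algebra.TensorProduct.tmul_mul_tmul, one_mul]
  let e : C ⊗[K] A ≃ₗ[C] RestrictRight K A C (A ⊗[K] C) :=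
    { σ with map_smul' := hσ }
  exact .of_equiv e

theorem projective [Projective (A ⊗[K] C) M] : Projective C (RestrictRight K A C M) := by
  have := free_tensorProduct (K := K) (A := A) (C := C)
  let F := M →₀ A ⊗[K] C
  have hF : Projective C (RestrictRight K A C F) :=
    .of_equiv' (M := M →₀ RestrictRight K A C (A ⊗[K] C))
      { AddEquiv.refl F with map_smul' := fun _ _ => Finsupp.ext fun _ => rfl }
  obtain ⟨s, hs⟩ := projective_lifting_property
    (Finsupp.linearCombination (A ⊗[K] C) (id : M → M)) LinearMap.id
    (Finsupp.linearCombination_id_surjective _ _)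
  refine .of_split (map s)
    (map (M := F) (Finsupp.linearCombination (A ⊗[K] C) (id : M → M))) ?_
  ext x
  exact LinearMap.congr_fun hs x

theorem mem_ker_smul_top_iff (χ : C →ₐ[K] K) (m : M) :
    m ∈ (RingHom.ker (evalRight A χ) • ⊤ : Submodule (A ⊗[K] C) M) ↔
      m ∈ (RingHom.ker χ • ⊤ : Submodule C (RestrictRight K A C M)) := by
  constructor
  · have key (b : A ⊗[K] C) (m : M) : b • m - (evalRight A χ b ⊗ₜ[K] (1 : C)) • m ∈
        (RingHom.ker χ • ⊤ : Submodule C (RestrictRight K A C M)) := by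
      induction b using TensorProduct.induction_on with
      | zero =>
        rw [map_zero, TensorProduct.zero_tmul, sub_self]
        exact zero_mem (RingHom.ker χ • ⊤ : Submodule C (RestrictRight K A C M))
      | add b b' hb hb' =>
        rw [map_add, TensorProduct.add_tmul, add_smul, add_smul, add_sub_add_comm]
        exact add_mem hb hb'
      | tmul a c =>
        have h : a ⊗ₜ[K] c - evalRight A χ (a ⊗ₜ c) ⊗ₜ[K] (1 : C) =
            ((1 : A) ⊗ₜ[K] (c - algebraMap K C (χ c))) * (a ⊗ₜ[K] (1 : C)) := by
          rw [evalRight_tmul, Algebra.TensorProduct.tmul_mul_tmul, one_mul, mul_one,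
            TensorProduct.tmul_sub, Algebra.algebraMap_eq_smul_one, TensorProduct.smul_tmul]
        rw [← sub_smul, h, mul_smul]
        exact Submodule.smul_mem_smul (M := RestrictRight K A C M)
          (by simp [RingHom.mem_ker]) Submodule.mem_top
    intro hm
    induction hm using Submodule.smul_induction_on' with
    | smul b hb m _ => simpa [RingHom.mem_ker.1 hb] using key b m
    | add m _ m' _ hm hm' => exact add_mem hm hm'
  · intro hm
    induction hm using Submodule.smul_induction_on' with
    | smul c hc m _ =>
      refine Submodule.smul_mem_smul (M := M) (r := (1 : A) ⊗ₜ[K] c) ?_ Submodule.mem_top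
      rw [RingHom.mem_ker, evalRight_tmul, RingHom.mem_ker.1 hc, zero_smul]
    | add m _ m' _ hm hm' => exact add_mem hm hm'

end RestrictRight

namespace Fiber

instance : AddCommGroup (Fiber A χ M) := inferInstanceAs
  (AddCommGroup (M ⧸ (RingHom.ker (evalRight A χ) • ⊤ : Submodule (A ⊗[K] C) M)))

instance : Module A (Fiber A χ M) :=
  Module.compHom (M ⧸ (RingHom.ker (evalRight A χ) • ⊤ : Submodule (A ⊗[K] C) M))
    (Algebra.TensorProduct.includeLeft : A →ₐ[K] A ⊗[K] C).toRingHom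

variable (A χ M) in
/-- The projection of a module onto its fiber. -/
def mk : M →ₛₗ[(evalRight A χ : A ⊗[K] C →+* A)] Fiber A χ M where
  toFun m := Submodule.Quotient.mk m
  map_add' _ _ := rfl
  map_smul' b m := by
    refine (Submodule.Quotient.eq _).2 ?_
    change b • m - (evalRight A χ b ⊗ₜ[K] (1 : C)) • m ∈ _
    rw [← sub_smul]
    refine Submodule.smul_mem_smul ?_ Submodule.mem_top
    rw [RingHom.mem_ker, map_sub, evalRight_tmul, map_one, one_smul, sub_self]

theorem mk_surjective : Function.Surjective (mk A χ M) := Submodule.Quotient.mk_surjective _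

theorem mk_smul (b : A ⊗[K] C) (m : M) : mk A χ M (b • m) = evalRight A χ b • mk A χ M m :=
  (mk A χ M).map_smulₛₗ b m

theorem smul_mk (a : A) (m : M) : a • mk A χ M m = mk A χ M ((a ⊗ₜ[K] (1 : C)) • m) := rfl

theorem mk_eq_zero (m : M) :
    mk A χ M m = 0 ↔ m ∈ (RingHom.ker (evalRight A χ) • ⊤ : Submodule (A ⊗[K] C) M) :=
  Submodule.Quotient.mk_eq_zero _

/-- The homomorphism out of the fiber induced by a homomorphism semilinear over `evalRight`. -/
def lift {Z : Type*} [AddCommGroup Z] [Module A Z]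
    (f : M →ₛₗ[(evalRight A χ : A ⊗[K] C →+* A)] Z) : Fiber A χ M →ₗ[A] Z where
  toFun := QuotientAddGroup.lift _ f.toAddMonoidHom (by
    intro m hm
    change m ∈ (RingHom.ker (evalRight A χ) • ⊤ : Submodule (A ⊗[K] C) M) at hm
    change f m = 0
    induction hm using Submodule.smul_induction_on' with
    | smul b hb m _ =>
      rw [map_smulₛₗ]
      change evalRight A χ b • f m = 0
      rw [RingHom.mem_ker.1 hb, zero_smul]
    | add m _ m' _ hm hm' => rw [map_add, hm, hm', add_zero])
  map_add' := map_add _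
  map_smul' a z := by
    obtain ⟨m, rfl⟩ := mk_surjective z
    rw [smul_mk]
    change f _ = a • f m
    rw [map_smulₛₗ]
    change evalRight A χ (a ⊗ₜ 1) • f m = a • f m
    rw [evalRight_tmul, map_one, one_smul]

variable (χ) in
/-- The homomorphism of fibers induced by a homomorphism of modules. -/
def map (f : M →ₗ[A ⊗[K] C] N) : Fiber A χ M →ₗ[A] Fiber A χ N := lift ((mk A χ N).comp f)

theorem map_mk (f : M →ₗ[A ⊗[K] C] N) (m : M) : map χ f (mk A χ M m) = mk A χ N (f m) := rfl

/-- Isomorphic modules have isomorphic fibers. -/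
def congr (e : M ≃ₗ[A ⊗[K] C] N) : Fiber A χ M ≃ₗ[A] Fiber A χ N :=
  .ofLinearMap (map χ e.toLinearMap) (map χ e.symm.toLinearMap)
    (LinearMap.ext fun z => by
      obtain ⟨n, rfl⟩ := mk_surjective z
      exact congrArg (mk A χ N) (e.apply_symm_apply n))
    (LinearMap.ext fun z => by
      obtain ⟨m, rfl⟩ := mk_surjective z
      exact congrArg (mk A χ M) (e.symm_apply_apply m))

theorem projective [Projective (A ⊗[K] C) P] : Projective A (Fiber A χ P) := by
  refine .of_lifting_property'' fun f hf => ?_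
  let _ : Module (A ⊗[K] C) (Fiber A χ P →₀ A) :=
    Module.compHom _ (evalRight A χ : A ⊗[K] C →+* A)
  let _ : Module (A ⊗[K] C) (Fiber A χ P) :=
    Module.compHom _ (evalRight A χ : A ⊗[K] C →+* A)
  let f' : (Fiber A χ P →₀ A) →ₗ[A ⊗[K] C] Fiber A χ P :=
    { f.toAddMonoidHom with map_smul' := fun b z => f.map_smul (evalRight A χ b) z }
  let q : P →ₗ[A ⊗[K] C] Fiber A χ P :=
    { (mk A χ P).toAddMonoidHom with map_smul' := mk_smul }
  obtain ⟨h, hh⟩ := projective_lifting_property f' q hf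
  let h' : P →ₛₗ[(evalRight A χ : A ⊗[K] C →+* A)] (Fiber A χ P →₀ A) :=
    { h.toAddMonoidHom with map_smul' := h.map_smul }
  refine ⟨lift h', LinearMap.ext fun z => ?_⟩
  obtain ⟨p, rfl⟩ := mk_surjective z
  exact LinearMap.congr_fun hh p

theorem map_surjective {π : P →ₗ[A ⊗[K] C] M} (hπ : Function.Surjective π) :
    Function.Surjective (map χ π) := by
  intro z
  obtain ⟨m, rfl⟩ := mk_surjective z
  obtain ⟨p, rfl⟩ := hπ m
  exact ⟨mk A χ P p, rfl⟩

theorem exists_mem_ker_of_map_eq_zero {π : P →ₗ[A ⊗[K] C] M} (hπ : Function.Surjective π)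
    {z : Fiber A χ P} (hz : map χ π z = 0) : ∃ p ∈ LinearMap.ker π, mk A χ P p = z := by
  obtain ⟨p, rfl⟩ := mk_surjective z
  rw [map_mk, mk_eq_zero, ← LinearMap.range_eq_top.2 hπ, ← Submodule.map_top,
    ← Submodule.map_smul''] at hz
  obtain ⟨q, hq, hqp⟩ := hz
  refine ⟨p - q, ?_, ?_⟩
  · rw [LinearMap.mem_ker, map_sub, hqp, sub_self]
  · rw [map_sub, (mk_eq_zero q).2 hq, sub_zero]

theorem map_injective_of_leftInverse {f : L →ₗ[A ⊗[K] C] P}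
    {ρ : RestrictRight K A C P →ₗ[C] RestrictRight K A C L}
    (hρ : ρ ∘ₗ RestrictRight.map f = LinearMap.id) : Function.Injective (map χ f) := by
  refine (injective_iff_map_eq_zero _).2 fun z hz => ?_
  obtain ⟨l, rfl⟩ := mk_surjective z
  rw [map_mk, mk_eq_zero, RestrictRight.mem_ker_smul_top_iff] at hz
  rw [mk_eq_zero, RestrictRight.mem_ker_smul_top_iff]
  have hle : (RingHom.ker χ • ⊤ : Submodule C (RestrictRight K A C P)).map ρ ≤
      RingHom.ker χ • ⊤ := by
    rw [Submodule.map_smul'']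
    exact Submodule.smul_mono le_rfl le_top
  have hρl : ρ (f l) = l := LinearMap.congr_fun hρ l
  exact hρl ▸ hle (Submodule.mem_map_of_mem hz)

theorem isProjectiveCover_map {P M : ModuleCat.{v} (A ⊗[K] C)} {π : P →ₗ[A ⊗[K] C] M}
    (hπ : IsProjectiveCover π) :
    IsProjectiveCover (P := .of A (Fiber A χ P)) (M := .of A (Fiber A χ M)) (map χ π) := by
  obtain ⟨hP, hsurj, hsuper⟩ := hπ
  refine ⟨projective, map_surjective hsurj, fun N hN => ?_⟩
  have htop : N.comap (mk A χ P) ⊔ LinearMap.ker π = ⊤ := by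
    refine eq_top_iff.2 fun p _ => ?_
    obtain ⟨n, hn, z, hz, hnz⟩ := Submodule.mem_sup.1 (hN ▸ Submodule.mem_top (x := mk A χ P p))
    obtain ⟨q, hq, rfl⟩ := exists_mem_ker_of_map_eq_zero hsurj hz
    refine Submodule.mem_sup.2 ⟨p - q, ?_, q, hq, sub_add_cancel p q⟩
    rwa [Submodule.mem_comap, map_sub, ← hnz, add_sub_cancel_right]
  refine eq_top_iff.2 fun z _ => ?_
  obtain ⟨p, rfl⟩ := mk_surjective z
  exact (hsuper _ htop ▸ Submodule.mem_top : p ∈ N.comap (mk A χ P))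

/-- Over `C` a projective cover of a module that is projective over `C` splits, so that it remains
exact after passing to fibers. -/
theorem isSyzygy {M L : ModuleCat.{v} (A ⊗[K] C)} [Projective C (RestrictRight K A C M)]
    (h : IsSyzygy M L) :
    IsSyzygy (.of A (Fiber A χ M)) (.of A (Fiber A χ L)) ∧
      Projective C (RestrictRight K A C L) := by
  obtain ⟨P, π, hπ, ⟨e⟩⟩ := h
  have := hπ.1
  have := RestrictRight.projective (K := K) (A := A) (C := C) (M := P)
  let f : L →ₗ[A ⊗[K] C] P := (LinearMap.ker π).subtype ∘ₗ e.toLinearMap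
  have hf : Function.Injective f := Subtype.val_injective.comp e.injective
  have hfπ : Function.Exact f π := LinearMap.exact_iff.2 (by
    rw [LinearMap.range_comp, LinearEquiv.range, Submodule.map_top, Submodule.range_subtype])
  have hexact : Function.Exact (RestrictRight.map f) (RestrictRight.map π) := hfπ
  obtain ⟨σ, hσ⟩ := projective_lifting_property (RestrictRight.map π) LinearMap.id hπ.2.1
  have hsplit := hexact.split_tfae'.out 0 1
  obtain ⟨-, ρ, hρ⟩ := hsplit.1 ⟨hf, σ, hσ⟩
  refine ⟨⟨_, _, isProjectiveCover_map hπ, ⟨.trans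
    (.ofInjective (map χ f) (map_injective_of_leftInverse hρ)) (.ofEq _ _ ?_)⟩⟩, .of_split _ ρ hρ⟩
  refine le_antisymm ?_ fun z hz => ?_
  · rintro _ ⟨z, rfl⟩
    obtain ⟨l, rfl⟩ := mk_surjective z
    exact (map_mk ..).trans ((congrArg _ (hfπ.apply_apply_eq_zero l)).trans (map_zero _))
  · obtain ⟨p, hp, rfl⟩ := exists_mem_ker_of_map_eq_zero hπ.2.1 hz
    obtain ⟨l, rfl⟩ := (hfπ p).1 hp
    exact ⟨mk A χ L l, rfl⟩

theorem isNthSyzygy {n : ℕ} {M N : ModuleCat.{v} (A ⊗[K] C)}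
    [Projective C (RestrictRight K A C M)] (h : IsNthSyzygy n M N) :
    IsNthSyzygy n (.of A (Fiber A χ M)) (.of A (Fiber A χ N)) := by
  induction n generalizing M with
  | zero => exact h.map congr
  | succ n ih =>
    obtain ⟨L, hML, hLN⟩ := h
    obtain ⟨hsyz, hL⟩ := isSyzygy (χ := χ) hML
    exact ⟨_, hsyz, ih hLN⟩

end Fiber

end Fibers

section Regular

variable {K : Type w} {A : Type u} [Field K] [Ring A] [Algebra K A]

variable (K A) in
/-- The identity map from `A` to the regular bimodule. -/
def toRegular : A ≃+ regularBimodule K A := .refl A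

theorem tmul_smul_toRegular (y : A) (z : Aᵐᵒᵖ) (x : A) :
    (y ⊗ₜ[K] z : A ⊗[K] Aᵐᵒᵖ) • toRegular K A x = toRegular K A (y * x * z.unop) := by
  let _ : Module (A ⊗[K] Aᵐᵒᵖ) A := instModuleTensorProductMop K A
  have h : (y ⊗ₜ[K] z : A ⊗[K] Aᵐᵒᵖ) • x = y * x * z.unop := by
    rw [TensorProduct.Algebra.smul_def, smul_eq_mul, MulOpposite.smul_eq_mul_unop, mul_assoc]
  exact h

theorem projective_regularBimodule :
    Projective Aᵐᵒᵖ (RestrictRight K A Aᵐᵒᵖ (regularBimodule K A)) :=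
  .of_equiv' (M := Aᵐᵒᵖ)
    { MulOpposite.opAddEquiv.symm.trans (toRegular K A) with
      map_smul' := fun z x => by
        refine .trans ?_ (tmul_smul_toRegular (K := K) 1 z x.unop).symm
        rw [one_mul]
        rfl }

namespace BasicIdempotents

variable {ι : Type*} [Fintype ι] (S : BasicIdempotents K A ι)

/-- The character `χ a` as a character of the opposite algebra. -/
def χop (a : ι) : Aᵐᵒᵖ →ₐ[K] K := .fromOpposite (S.χ a) fun _ _ => .all _ _

theorem χop_apply (a : ι) (z : Aᵐᵒᵖ) : S.χop a z = S.χ a z.unop := rfl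

theorem evalRight_χop_smul (a : ι) (b : A ⊗[K] Aᵐᵒᵖ) (x : A) :
    S.χ a ((toRegular K A).symm (b • toRegular K A x)) =
      S.χ a (evalRight A (S.χop a) b) * S.χ a x := by
  induction b using TensorProduct.induction_on with
  | zero =>
    have h : (0 : A ⊗[K] Aᵐᵒᵖ) • toRegular K A x = 0 :=
      zero_smul (A ⊗[K] Aᵐᵒᵖ) (toRegular K A x)
    rw [map_zero, map_zero, zero_mul, h, map_zero, map_zero]
  | add b b' h h' => rw [add_smul, map_add, map_add, h, h', map_add, map_add, add_mul]
  | tmul y z =>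
    rw [tmul_smul_toRegular, AddEquiv.symm_apply_apply, map_mul, map_mul, evalRight_tmul, map_smul,
      smul_eq_mul, χop_apply]
    ring

theorem nonempty_fiber_regularBimodule_equiv_simple (a : ι) :
    Nonempty (Fiber A (S.χop a) (regularBimodule K A) ≃ₗ[A] S.Simple a) := by
  let f : regularBimodule K A →ₛₗ[(evalRight A (S.χop a) : A ⊗[K] Aᵐᵒᵖ →+* A)] S.Simple a :=
    { ((S.χ a).toLinearMap.toAddMonoidHom.comp (toRegular K A).symm.toAddMonoidHom) with
      map_smul' := fun b x => S.evalRight_χop_smul a b ((toRegular K A).symm x) }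
  refine ⟨.ofBijective (Fiber.lift f) ⟨(injective_iff_map_eq_zero _).2 fun z hz => ?_, fun k => ?_⟩⟩
  · obtain ⟨m, rfl⟩ := Fiber.mk_surjective z
    obtain ⟨x, rfl⟩ := (toRegular K A).surjective m
    have hx : S.χ a x = 0 := hz
    have hx' : toRegular K A x = (1 ⊗ₜ[K] .op x : A ⊗[K] Aᵐᵒᵖ) • toRegular K A 1 := by
      rw [tmul_smul_toRegular, MulOpposite.unop_op, one_mul, one_mul]
    rw [hx', Fiber.mk_smul, evalRight_tmul, χop_apply, MulOpposite.unop_op, hx,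
      zero_smul, zero_smul]
  · exact ⟨Fiber.mk A _ _ (toRegular K A (algebraMap K A k)), (S.χ a).commutes k⟩

theorem nonempty_periodicResolution_of_isNthSyzygy_regularBimodule [IsNoetherianRing A]
    (h : IsNthSyzygy 4 (regularBimodule K A) (regularBimodule K A)) (a : ι) :
    Nonempty (PeriodicResolution.{u, u} S a) := by
  have := projective_regularBimodule (K := K) (A := A)
  obtain ⟨e⟩ := S.nonempty_fiber_regularBimodule_equiv_simple a
  exact S.nonempty_periodicResolution (Fiber.isNthSyzygy (χ := S.χop a) h) e

end BasicIdempotents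

end Regular

/-! ### Bound quiver algebras -/

theorem mem_jacobson_of_forall_isNilpotent_mul {R : Type*} [Ring R] {r : R}
    (h : ∀ y, IsNilpotent (y * r)) : r ∈ Ring.jacobson R := by
  rw [← Ideal.jacobson_bot, Ideal.mem_jacobson_iff]
  intro y
  obtain ⟨z, hz⟩ := (h y).isUnit_one_add
  refine ⟨(z⁻¹ : Rˣ), ?_⟩
  rw [Ideal.mem_bot, sub_eq_zero, ← z.inv_mul, hz, mul_add, mul_one, mul_assoc, add_comm]

namespace PathAlgebra

variable {V : Type u} [Quiver.{v} V]

theorem finite_paths_of_length [Finite V] [∀ a b : V, Finite (a ⟶ b)] (n : ℕ) (a b : V) :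
    Finite {p : Quiver.Path a b // p.length = n} := by
  induction n generalizing b with
  | zero =>
    have : Subsingleton {p : Quiver.Path a b // p.length = 0} := by
      refine ⟨?_⟩
      rintro ⟨p, hp⟩ ⟨q, hq⟩
      obtain rfl := Quiver.Path.eq_of_length_zero p hp
      rw [Subtype.mk.injEq, Quiver.Path.eq_nil_of_length_zero p hp,
        Quiver.Path.eq_nil_of_length_zero q hq]
    infer_instance
  | succ n ih =>
    refine .of_surjective
      (fun x : Σ c : V, {p : Quiver.Path a c // p.length = n} × (c ⟶ b) =>
        (⟨x.2.1.1.cons x.2.2, by rw [Quiver.Path.length_cons, x.2.1.2]⟩ :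
          {p : Quiver.Path a b // p.length = n + 1})) ?_
    rintro ⟨p, hp⟩
    cases p with
    | nil => simp at hp
    | @cons c _ q α => exact ⟨⟨c, ⟨q, by simpa using hp⟩, α⟩, rfl⟩

variable {K : Type w} [Field K]

theorem ofPath_cons {a b c : V} (p : Quiver.Path a b) (α : b ⟶ c) :
    (ofPath (p.cons α) : PathAlgebra K V) = ofPath p * ofPath α.toPath := by
  rw [ofPath_mul_comp, Quiver.Path.comp_toPath_eq_cons]

theorem ofPath_mem_arrowIdeal {a b : V} {p : Quiver.Path a b} (hp : 1 ≤ p.length) :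
    ofPath p ∈ arrowIdeal K V :=
  Submodule.subset_span ⟨a, b, p, hp, rfl⟩

/-- The coefficient of a path in an element of the path algebra. -/
def pathCoeff {a b : V} (p : Quiver.Path a b) : PathAlgebra K V →ₗ[K] K :=
  (pathBasis K V).coord ⟨a, b, p⟩

open Classical in
theorem pathCoeff_ofPath {a b x y : V} (p : Quiver.Path a b) (q : Quiver.Path x y) :
    pathCoeff p (ofPath q : PathAlgebra K V) =
      if (⟨x, y, q⟩ : AllPaths V) = ⟨a, b, p⟩ then 1 else 0 := by
  rw [pathCoeff, ofPath, Basis.coord_apply, Basis.repr_self, Finsupp.single_apply]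

theorem pathCoeff_ofPath_self {a b : V} (p : Quiver.Path a b) :
    pathCoeff p (ofPath p : PathAlgebra K V) = 1 := by
  rw [pathCoeff_ofPath, if_pos rfl]

theorem pathCoeff_ofPath_of_source_ne {a b x y : V} {p : Quiver.Path a b} {q : Quiver.Path x y}
    (h : x ≠ a) : pathCoeff p (ofPath q : PathAlgebra K V) = 0 := by
  rw [pathCoeff_ofPath, if_neg fun hpq => h (congrArg Sigma.fst hpq)]

theorem pathCoeff_ofPath_of_length_ne {a b x y : V} {p : Quiver.Path a b} {q : Quiver.Path x y}
    (h : q.length ≠ p.length) : pathCoeff p (ofPath q : PathAlgebra K V) = 0 := by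
  rw [pathCoeff_ofPath, if_neg fun hpq => h (congrArg (fun r : AllPaths V => r.2.2.length) hpq)]

open Classical in
theorem pathCoeff_nil_ofPath (a : V) {x y : V} (q : Quiver.Path x y) :
    pathCoeff (.nil : Quiver.Path a a) (ofPath q : PathAlgebra K V) =
      if q.length = 0 ∧ x = a then 1 else 0 := by
  split_ifs with h
  · obtain ⟨hq, rfl⟩ := h
    obtain rfl := Quiver.Path.eq_of_length_zero q hq
    rw [Quiver.Path.eq_nil_of_length_zero q hq, pathCoeff_ofPath_self]
  · rcases not_and_or.1 h with hq | hx
    · exact pathCoeff_ofPath_of_length_ne hq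
    · exact pathCoeff_ofPath_of_source_ne hx

theorem pathCoeff_nil_ofPath_mul_ofPath (a : V) {x y z t : V} (p : Quiver.Path x y)
    (q : Quiver.Path z t) :
    pathCoeff (.nil : Quiver.Path a a) (ofPath p * ofPath q : PathAlgebra K V) =
      pathCoeff (.nil : Quiver.Path a a) (ofPath p : PathAlgebra K V) *
        pathCoeff (.nil : Quiver.Path a a) (ofPath q : PathAlgebra K V) := by
  classical
  by_cases hz : z = y
  · subst hz
    rw [ofPath_mul_comp]
    simp only [pathCoeff_nil_ofPath, Quiver.Path.length_comp]
    by_cases hp : p.length = 0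
    · obtain rfl := Quiver.Path.eq_of_length_zero p hp
      simp only [hp, zero_add, true_and]
      split_ifs <;> simp_all
    · simp [hp]
  · rw [ofPath_mul_of_ne _ _ hz, map_zero, pathCoeff_nil_ofPath, pathCoeff_nil_ofPath]
    by_cases hp : p.length = 0 ∧ x = a
    · rw [if_neg (c := q.length = 0 ∧ z = a), mul_zero]
      rintro ⟨-, h⟩
      exact hz (h.trans (hp.2.symm.trans (Quiver.Path.eq_of_length_zero p hp.1)))
    · rw [if_neg hp, zero_mul]

theorem pathCoeff_nil_mul (a : V) (f g : PathAlgebra K V) :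
    pathCoeff (.nil : Quiver.Path a a) (f * g) =
      pathCoeff (.nil : Quiver.Path a a) f * pathCoeff (.nil : Quiver.Path a a) g := by
  induction f using induction_ofPath with
  | h0 => rw [zero_mul_aux, map_zero, zero_mul]
  | hadd f₁ f₂ h₁ h₂ => rw [add_mul_aux, map_add, map_add, h₁, h₂, add_mul]
  | hsmul c x y p =>
  induction g using induction_ofPath with
  | h0 => rw [mul_zero_aux, map_zero, mul_zero]
  | hadd f₁ f₂ h₁ h₂ => rw [mul_add_aux, map_add, map_add, h₁, h₂, mul_add]
  | hsmul c' z t q =>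
    rw [smul_mul_aux, mul_smul_aux, map_smul, map_smul, map_smul, map_smul,
      pathCoeff_nil_ofPath_mul_ofPath, ← mul_smul_comm, smul_mul_assoc]

variable [Fintype V]

theorem ofPath_mem_arrowIdeal_pow (n : ℕ) {a b : V} (p : Quiver.Path a b)
    (hp : n + 1 ≤ p.length) : ofPath p ∈ arrowIdeal K V ^ (n + 1) := by
  induction n generalizing b with
  | zero => simpa only [zero_add, pow_one] using ofPath_mem_arrowIdeal hp
  | succ n ih =>
    cases p with
    | nil => simp at hp
    | cons q α =>
      rw [pow_succ, ofPath_cons]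
      exact Submodule.mul_mem_mul (ih q (by simpa using hp)) (ofPath_mem_arrowIdeal (by simp))

theorem arrowIdeal_sq_le {W : Submodule K (PathAlgebra K V)}
    (hW : ∀ (a b : V) (p : Quiver.Path a b), 2 ≤ p.length → ofPath p ∈ W) :
    arrowIdeal K V ^ 2 ≤ W := by
  rw [pow_two, arrowIdeal, Submodule.span_mul_span, Submodule.span_le]
  rintro _ ⟨_, ⟨a, b, p, hp, rfl⟩, _, ⟨c, d, q, hq, rfl⟩, rfl⟩
  simp only [SetLike.mem_coe]
  by_cases h : c = b
  · subst h
    rw [ofPath_mul_comp]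
    exact hW _ _ _ (by rw [Quiver.Path.length_comp]; omega)
  · rw [ofPath_mul_of_ne _ _ h]
    exact W.zero_mem

theorem pathCoeff_eq_zero_of_mem_arrowIdeal_sq {a b : V} {p : Quiver.Path a b} (hp : p.length ≤ 1)
    {f : PathAlgebra K V} (hf : f ∈ arrowIdeal K V ^ 2) : pathCoeff p f = 0 :=
  arrowIdeal_sq_le (W := LinearMap.ker (pathCoeff p))
    (fun _ _ _ hq => pathCoeff_ofPath_of_length_ne (by omega)) hf

/-- The character of the path algebra at a vertex, which annihilates the arrow ideal. -/
def vertexChar (a : V) : PathAlgebra K V →ₐ[K] K :=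
  .ofLinearMap (pathCoeff (.nil : Quiver.Path a a))
    (by
      rw [one_def, map_sum, Finset.sum_eq_single a (fun b _ hb => pathCoeff_ofPath_of_source_ne hb)
        (by simp), pathCoeff_ofPath_self])
    (pathCoeff_nil_mul a)

theorem vertexChar_nil (a : V) :
    vertexChar a (ofPath (.nil : Quiver.Path a a) : PathAlgebra K V) = 1 :=
  pathCoeff_ofPath_self _

theorem vertexChar_ofPath_of_source_ne {a x y : V} {q : Quiver.Path x y} (h : x ≠ a) :
    vertexChar a (ofPath q : PathAlgebra K V) = 0 :=
  pathCoeff_ofPath_of_source_ne h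

theorem vertexChar_ofPath_of_one_le_length (a : V) {x y : V} {q : Quiver.Path x y}
    (h : 1 ≤ q.length) : vertexChar a (ofPath q : PathAlgebra K V) = 0 :=
  pathCoeff_ofPath_of_length_ne (by rw [Quiver.Path.length_nil]; omega)

theorem sub_sum_mem_arrowIdeal (f : PathAlgebra K V) :
    f - ∑ a, vertexChar a f • ofPath (.nil : Quiver.Path a a) ∈ arrowIdeal K V := by
  induction f using induction_ofPath with
  | h0 => simp only [map_zero, zero_smul, Finset.sum_const_zero, sub_zero, zero_mem]
  | hadd f g hf hg =>
    simp only [map_add, add_smul, Finset.sum_add_distrib]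
    rw [add_sub_add_comm]
    exact add_mem hf hg
  | hsmul c x y p =>
    simp only [map_smul, smul_assoc, ← Finset.smul_sum, ← smul_sub]
    refine Submodule.smul_mem _ c ?_
    by_cases hp : p.length = 0
    · obtain rfl := Quiver.Path.eq_of_length_zero p hp
      rw [Quiver.Path.eq_nil_of_length_zero p hp, Finset.sum_eq_single x, vertexChar_nil, one_smul,
        sub_self]
      · exact zero_mem _
      · intro a _ ha
        rw [vertexChar_ofPath_of_source_ne ha.symm, zero_smul]
      · simp
    · have hp' : 1 ≤ p.length := Nat.one_le_iff_ne_zero.2 hp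
      simpa only [vertexChar_ofPath_of_one_le_length _ hp', zero_smul, Finset.sum_const_zero,
        sub_zero] using ofPath_mem_arrowIdeal hp'

theorem mem_arrowIdeal_iff {f : PathAlgebra K V} :
    f ∈ arrowIdeal K V ↔ ∀ a, vertexChar a f = 0 := by
  refine ⟨fun hf a => ?_, fun h => by simpa [h] using sub_sum_mem_arrowIdeal f⟩
  refine (Submodule.span_le (p := LinearMap.ker (vertexChar a).toLinearMap)).2 ?_ hf
  rintro _ ⟨x, y, p, hp, rfl⟩
  exact vertexChar_ofPath_of_one_le_length a hp

theorem pathCoeff_nil_mul_eq {a b y : V} (p : Quiver.Path a b) (f : PathAlgebra K V) :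
    pathCoeff p (ofPath (.nil : Quiver.Path y y) * f) =
      vertexChar a (ofPath (.nil : Quiver.Path y y) : PathAlgebra K V) * pathCoeff p f := by
  induction f using induction_ofPath with
  | h0 => rw [mul_zero, map_zero, mul_zero]
  | hadd f g hf hg => rw [mul_add, map_add, map_add, hf, hg, mul_add]
  | hsmul c x z q =>
    rw [mul_smul_comm, map_smul, map_smul, mul_smul_comm]
    congr 1
    by_cases hx : x = y
    · subst hx
      rw [ofPath_mul_comp, Quiver.Path.nil_comp]
      by_cases hxa : x = a
      · subst hxa
        rw [vertexChar_nil, one_mul]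
      · rw [pathCoeff_ofPath_of_source_ne hxa, mul_zero]
    · rw [ofPath_mul_of_ne _ _ hx, map_zero]
      by_cases hxa : x = a
      · rw [vertexChar_ofPath_of_source_ne (hxa ▸ Ne.symm hx), zero_mul]
      · rw [pathCoeff_ofPath_of_source_ne hxa, mul_zero]

theorem pathCoeff_toPath_mul {a b : V} (α : a ⟶ b) (r : PathAlgebra K V) {f : PathAlgebra K V}
    (hf : f ∈ arrowIdeal K V) :
    pathCoeff α.toPath (r * f) = vertexChar a r * pathCoeff α.toPath f := by
  let s := ∑ y, vertexChar y r • (ofPath (.nil : Quiver.Path y y) : PathAlgebra K V)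
  have hrs : r - s ∈ arrowIdeal K V := sub_sum_mem_arrowIdeal r
  have hsq : (r - s) * f ∈ arrowIdeal K V ^ 2 := pow_two (arrowIdeal K V) ▸
    Submodule.mul_mem_mul hrs hf
  have hr : pathCoeff α.toPath (r * f) = pathCoeff α.toPath (s * f) := by
    rw [← sub_eq_zero, ← map_sub, ← sub_mul]
    exact pathCoeff_eq_zero_of_mem_arrowIdeal_sq (by simp) hsq
  have hχ : vertexChar a r = vertexChar a s := by
    rw [← sub_eq_zero, ← map_sub]
    exact mem_arrowIdeal_iff.1 hrs a
  rw [hr, hχ]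
  simp only [s, Finset.sum_mul, map_sum, smul_mul_assoc, map_smul, pathCoeff_nil_mul_eq]

end PathAlgebra

namespace PathAlgebra.IsAdmissible

variable {K : Type w} [Field K] {V : Type u} [Quiver.{v} V] [Fintype V]
  {I : Ideal (PathAlgebra K V)} [I.IsTwoSided] (hI : IsAdmissible I)

include hI

theorem isNilpotent_mk {f : PathAlgebra K V} (hf : f ∈ arrowIdeal K V) :
    IsNilpotent (Ideal.Quotient.mk I f) := by
  obtain ⟨m, -, hm⟩ := hI.2
  refine ⟨m, ?_⟩
  rw [← map_pow]
  exact Ideal.Quotient.eq_zero_iff_mem.2 (hm (Submodule.pow_mem_pow _ hf m))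

theorem finiteDimensional [∀ a b : V, Finite (a ⟶ b)] :
    FiniteDimensional K (PathAlgebra K V ⧸ I) := by
  obtain ⟨m, hm2, hm⟩ := hI.2
  obtain ⟨n, rfl⟩ : ∃ n, m = n + 1 := ⟨m - 1, by omega⟩
  have (l : ℕ) (a b : V) : Finite {p : Quiver.Path a b // p.length = l} :=
    finite_paths_of_length l a b
  let g : (Σ (l : Fin (n + 1)) (a b : V), {p : Quiver.Path a b // p.length = l}) →
      PathAlgebra K V ⧸ I := fun t => Ideal.Quotient.mk I (ofPath t.2.2.2.1)
  suffices hspan : Submodule.span K (Set.range g) = ⊤ from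
    ⟨⟨(Set.finite_range g).toFinset, by rwa [Set.Finite.coe_toFinset]⟩⟩
  rw [eq_top_iff]
  rintro r -
  obtain ⟨f, rfl⟩ := Ideal.Quotient.mkₐ_surjective K I r
  induction f using induction_ofPath with
  | h0 => rw [map_zero]; exact zero_mem _
  | hadd f g hf hg => rw [map_add]; exact add_mem hf hg
  | hsmul c a b p =>
    rw [map_smul]
    refine Submodule.smul_mem _ _ ?_
    by_cases hp : p.length < n + 1
    · exact Submodule.subset_span ⟨⟨⟨p.length, hp⟩, a, b, p, rfl⟩, rfl⟩
    · rw [Ideal.Quotient.mkₐ_eq_mk, Ideal.Quotient.eq_zero_iff_mem.2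
        (hm (ofPath_mem_arrowIdeal_pow n p (by omega)))]
      exact zero_mem _

/-- The basic idempotents of a bound quiver algebra: the classes of the trivial paths. -/
def basicIdempotents : BasicIdempotents K (PathAlgebra K V ⧸ I) V where
  e a := Ideal.Quotient.mk I (ofPath (.nil : Quiver.Path a a))
  complete :=
    { idem a := by rw [IsIdempotentElem, ← map_mul, ofPath_mul_comp, Quiver.Path.nil_comp]
      ortho a b hab := by
        simp only [← map_mul, ofPath_mul_of_ne _ _ hab.symm, map_zero]
      complete := by rw [← map_sum, ← one_def, map_one] }
  χ a := Ideal.Quotient.liftₐ I (vertexChar a) fun _ hf =>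
    pathCoeff_eq_zero_of_mem_arrowIdeal_sq (p := .nil) zero_le_one (hI.1 hf)
  χ_e_self := vertexChar_nil
  mem_jacobson r hr := mem_jacobson_of_forall_isNilpotent_mul fun y => by
    obtain ⟨f, rfl⟩ := Ideal.Quotient.mk_surjective r
    obtain ⟨g, rfl⟩ := Ideal.Quotient.mk_surjective y
    rw [← map_mul]
    refine hI.isNilpotent_mk (mem_arrowIdeal_iff.2 fun a => ?_)
    rw [map_mul, show vertexChar a f = 0 from hr a, mul_zero]

theorem basicIdempotents_e (a : V) :
    hI.basicIdempotents.e a = Ideal.Quotient.mk I (ofPath (.nil : Quiver.Path a a)) := rfl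

theorem basicIdempotents_χ_mk (a : V) (f : PathAlgebra K V) :
    hI.basicIdempotents.χ a (Ideal.Quotient.mk I f) = vertexChar a f := rfl

theorem mk_ofPath_mul_e {a b : V} (p : Quiver.Path b a) :
    Ideal.Quotient.mk I (ofPath p) * hI.basicIdempotents.e a = Ideal.Quotient.mk I (ofPath p) := by
  rw [basicIdempotents_e, ← map_mul, ofPath_mul_comp, Quiver.Path.comp_nil]

/-- An arrow ending at `a` as an element of the radical of the projective module at `a`. -/
def radArrow {a : V} (α : Quiver.Costar a) : LinearMap.ker (hI.basicIdempotents.top a) :=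
  ⟨⟨Ideal.Quotient.mk I (ofPath α.2.toPath),
      Ideal.mem_span_singleton'.2 ⟨_, hI.mk_ofPath_mul_e _⟩⟩, by
    rw [LinearMap.mem_ker, BasicIdempotents.top_apply, basicIdempotents_χ_mk,
      vertexChar_ofPath_of_one_le_length a (by simp), zero_smul]⟩

theorem exists_mem_arrowIdeal {a : V} (x : LinearMap.ker (hI.basicIdempotents.top a)) :
    ∃ f ∈ arrowIdeal K V, Ideal.Quotient.mk I f = x := by
  obtain ⟨f, hf⟩ := Ideal.Quotient.mk_surjective (x : PathAlgebra K V ⧸ I)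
  refine ⟨f, mem_arrowIdeal_iff.2 fun b => ?_, hf⟩
  rw [← hI.basicIdempotents_χ_mk, hf]
  rcases eq_or_ne b a with rfl | hba
  · exact (smul_eq_zero.1 (LinearMap.mem_ker.1 x.2)).resolve_right
      (hI.basicIdempotents.simpleGen_ne_zero b)
  · rw [← hI.basicIdempotents.mul_e_of_mem_proj x.1.2, map_mul,
      hI.basicIdempotents.χ_e_of_ne hba, mul_zero]

theorem mk_mul_e_mem_span {a : V} {f : PathAlgebra K V} (hf : f ∈ arrowIdeal K V) :
    Ideal.Quotient.mk I f * hI.basicIdempotents.e a ∈ Ideal.span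
      (Set.range fun α : Quiver.Costar a => Ideal.Quotient.mk I (ofPath α.2.toPath)) := by
  induction hf using Submodule.span_induction with
  | zero => rw [map_zero, zero_mul]; exact zero_mem _
  | add f g _ _ hf hg => rw [map_add, add_mul]; exact add_mem hf hg
  | smul c f _ hf =>
    rw [← Ideal.Quotient.mkₐ_eq_mk K, map_smul, smul_mul_assoc]
    exact Submodule.smul_of_tower_mem _ c hf
  | mem _ hf =>
    obtain ⟨x, y, p, hp, rfl⟩ := hf
    by_cases hay : a = y
    · subst hay
      cases p with
      | nil => simp at hp
      | @cons z _ q α =>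
        rw [mk_ofPath_mul_e, ofPath_cons, map_mul]
        exact Ideal.mul_mem_left _ _ (Ideal.subset_span ⟨⟨z, α⟩, rfl⟩)
    · rw [basicIdempotents_e, ← map_mul, ofPath_mul_of_ne _ _ hay, map_zero]
      exact zero_mem _

theorem span_range_radArrow (a : V) :
    Submodule.span (PathAlgebra K V ⧸ I) (Set.range (hI.radArrow (a := a))) = ⊤ := by
  let ι := (hI.basicIdempotents.proj a).subtype ∘ₗ
    (LinearMap.ker (hI.basicIdempotents.top a)).subtype
  have hι : Function.Injective ι := Subtype.val_injective.comp Subtype.val_injective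
  refine eq_top_iff.2 fun x _ => hι.mem_set_image.1 ?_
  obtain ⟨f, hf, hfx⟩ := hI.exists_mem_arrowIdeal x
  rw [← Submodule.map_coe, Submodule.map_span, ← Set.range_comp]
  have h := hI.mk_mul_e_mem_span (a := a) hf
  rwa [hfx, hI.basicIdempotents.mul_e_of_mem_proj x.1.2] at h

theorem hom_apply_radArrow_of_ne {a b : V} {α : Quiver.Costar a} (h : b ≠ α.1)
    (φ : LinearMap.ker (hI.basicIdempotents.top a) →ₗ[PathAlgebra K V ⧸ I]
      hI.basicIdempotents.Simple b) : φ (hI.radArrow α) = 0 := by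
  have hα : hI.basicIdempotents.e α.1 • hI.radArrow α = hI.radArrow α := by
    refine Subtype.ext (Subtype.ext ?_)
    change Ideal.Quotient.mk I _ * Ideal.Quotient.mk I _ = Ideal.Quotient.mk I _
    rw [← map_mul, ofPath_mul_comp, Quiver.Path.nil_comp]
  rw [← hα, map_smul, BasicIdempotents.smul_simple, hI.basicIdempotents.χ_e_of_ne h, zero_smul]

/-- The homomorphism from the radical of the projective module at `a` to the simple module at `b`
that reads off the coefficient of an arrow from `b` to `a`. -/
def arrowHom {a b : V} (α : b ⟶ a) :
    LinearMap.ker (hI.basicIdempotents.top a) →ₗ[PathAlgebra K V ⧸ I]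
      hI.basicIdempotents.Simple b :=
  let c : PathAlgebra K V ⧸ I →ₗ[K] K := (I.restrictScalars K).liftQ (pathCoeff α.toPath)
    fun _ hf => pathCoeff_eq_zero_of_mem_arrowIdeal_sq le_rfl (hI.1 hf)
  { toFun x := c x
    map_add' x y := c.map_add x y
    map_smul' r x := by
      obtain ⟨f, hf, hfx⟩ := hI.exists_mem_arrowIdeal x
      obtain ⟨g, rfl⟩ := Ideal.Quotient.mk_surjective r
      change c (Ideal.Quotient.mk I g * x) = vertexChar b g * c x
      rw [← hfx, ← map_mul]
      exact pathCoeff_toPath_mul α g hf }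

theorem arrowHom_radArrow {a b : V} (α : b ⟶ a) (β : Quiver.Costar a) :
    hI.arrowHom α (hI.radArrow β) = pathCoeff α.toPath (ofPath β.2.toPath : PathAlgebra K V) := rfl

theorem extDim_basicIdempotents [∀ a b : V, Finite (a ⟶ b)] (a b : V) :
    hI.basicIdempotents.extDim a b = Nat.card (b ⟶ a) := by
  classical
  have := Fintype.ofFinite (b ⟶ a)
  let F : (LinearMap.ker (hI.basicIdempotents.top a) →ₗ[PathAlgebra K V ⧸ I]
      hI.basicIdempotents.Simple b) →ₗ[K] (b ⟶ a) → K :=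
    { toFun φ α := φ (hI.radArrow ⟨b, α⟩)
      map_add' _ _ := rfl
      map_smul' _ _ := rfl }
  have hF : Function.Bijective F := by
    constructor
    · refine (injective_iff_map_eq_zero F).2 fun φ hφ => ?_
      refine LinearMap.ext_on (hI.span_range_radArrow a) ?_
      rintro _ ⟨⟨y, α⟩, rfl⟩
      rcases eq_or_ne b y with rfl | hby
      · exact congrFun hφ α
      · exact hI.hom_apply_radArrow_of_ne hby φ
    · rw [← LinearMap.range_eq_top, eq_top_iff, ← (Pi.basisFun K (b ⟶ a)).span_eq,
        Submodule.span_le]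
      rintro _ ⟨α, rfl⟩
      refine ⟨hI.arrowHom α, funext fun α' => ?_⟩
      refine (hI.arrowHom_radArrow α ⟨b, α'⟩).trans ?_
      rw [Pi.basisFun_apply]
      rcases eq_or_ne α' α with rfl | hne
      · rw [pathCoeff_ofPath_self, Pi.single_eq_same]
      · rw [pathCoeff_ofPath, if_neg (by simpa [Quiver.Hom.toPath] using hne),
          Pi.single_eq_of_ne hne]
  rw [Nat.card_eq_fintype_card, ← finrank_fintype_fun_eq_card K]
  exact (LinearEquiv.ofBijective F hF).finrank_eq

end PathAlgebra.IsAdmissible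

/-! ### A `1`-vertex with a loop -/

namespace IsIndecomposableModule

theorem of_bijective {R : Type*} {S : Type*} [Ring R] [Ring S] {σ : R →+* S}
    [RingHomSurjective σ] {M N : Type*} [AddCommGroup M] [Module R M] [AddCommGroup N] [Module S N]
    (f : M →ₛₗ[σ] N) (hf : Function.Bijective f) (hN : IsIndecomposableModule S N) :
    IsIndecomposableModule R M := by
  let e := Submodule.orderIsoMapComapOfBijective f hf
  have := hN.1
  refine ⟨hf.surjective.nontrivial, fun L L' h => ?_⟩
  simpa only [map_eq_bot_iff] using hN.2 (e L) (e L') (e.isCompl h)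

theorem bijective_of_comp_eq_id {R : Type*} [Ring R] {M N : Type*} [AddCommGroup M]
    [Module R M] [AddCommGroup N] [Module R N] (hN : IsIndecomposableModule R N) {r : N →ₗ[R] M}
    {s : M →ₗ[R] N} (hrs : r ∘ₗ s = .id) (hr : r ≠ 0) : Function.Bijective r := by
  have hrs' (x : M) : r (s x) = x := LinearMap.congr_fun hrs x
  have hidem : IsIdempotentElem (s ∘ₗ r : End R N) := LinearMap.ext fun x => congrArg s (hrs' _)
  refine ⟨LinearMap.ker_eq_bot.1 (le_bot_iff.1 ?_), fun x => ⟨s x, hrs' x⟩⟩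
  rcases hN.2 _ _ (LinearMap.IsIdempotentElem.isCompl hidem) with h | h
  · refine absurd (LinearMap.ext fun x => ?_) hr
    have hx : s (r x) = 0 := LinearMap.congr_fun (LinearMap.range_eq_bot.1 h) x
    rw [← hrs' (r x), hx, map_zero, LinearMap.zero_apply]
  · rw [← h]
    exact LinearMap.ker_le_ker_comp r s

section PrincipalIdealRing

variable {P : Type*} [CommRing P] [IsDomain P] [IsPrincipalIdealRing P] {p : P}
  (hp : Irreducible p)

include hp

open scoped DirectSum in
theorem exists_equiv_quotient_span_pow_of_isTorsion' {N : Type*} [AddCommGroup N] [Module P N]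
    [Module.Finite P N] (hN : IsIndecomposableModule P N)
    (htors : IsTorsion' N (Submonoid.powers p)) :
    ∃ k : ℕ, Nonempty (N ≃ₗ[P] P ⧸ Ideal.span {p ^ k}) := by
  obtain ⟨d, k, ⟨e⟩⟩ := torsion_by_prime_power_decomposition hp htors
  have := hN.1
  obtain ⟨n, hn⟩ := exists_ne (0 : N)
  obtain ⟨l, hl⟩ : ∃ l, e n l ≠ 0 := by
    by_contra! h
    exact hn (e.map_eq_zero_iff.1 (DFinsupp.ext h))
  let Q (l : Fin d) := P ⧸ Submodule.span P {p ^ k l}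
  have hrs : (DirectSum.component P _ Q l ∘ₗ e.toLinearMap) ∘ₗ
      (e.symm.toLinearMap ∘ₗ DirectSum.lof P _ Q l) = .id := by
    ext
    simp [Q]
  exact ⟨k l, ⟨.ofBijective _
    (hN.bijective_of_comp_eq_id hrs fun h => hl (LinearMap.congr_fun h n))⟩⟩

theorem exists_equiv_quotient_span_pow {R : Type*} [Ring R] {f : P →+* R}
    (hf : Function.Surjective f) {m : ℕ} (hm : f p ^ m = 0) {N : Type*} [AddCommGroup N]
    [Module R N] [Module.Finite R N] (hN : IsIndecomposableModule R N) :
    ∃ k ≤ m, Nonempty (N ≃ₗ[R] R ⧸ Ideal.span {f p ^ k}) := by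
  let : Module P N := Module.compHom N f
  have : RingHomSurjective f := ⟨hf⟩
  let ι : N →ₛₗ[f] N := { AddMonoidHom.id N with map_smul' := fun _ _ => rfl }
  have hι : Function.Bijective ι := Function.bijective_id
  have : Module.Finite P N := (ι.finite_iff_of_bijective hι).2 inferInstance
  obtain ⟨k, ⟨e⟩⟩ := (hN.of_bijective ι hι).exists_equiv_quotient_span_pow_of_isTorsion' hp
    fun n => ⟨⟨p ^ m, m, rfl⟩, show f (p ^ m) • n = 0 by rw [map_pow, hm, zero_smul]⟩
  let g : N := e.symm (Ideal.Quotient.mk _ 1)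
  have hg (q : P) : f q • g = e.symm (Ideal.Quotient.mk _ q) := by
    change q • e.symm _ = _
    rw [← map_smul, ← Ideal.Quotient.mk_eq_mk, ← Submodule.Quotient.mk_smul, smul_eq_mul, mul_one]
    rfl
  have hg_zero (q : P) : f q • g = 0 ↔ p ^ k ∣ q := by
    rw [hg, e.symm.map_eq_zero_iff, Ideal.Quotient.eq_zero_iff_dvd]
  have hsurj : Function.Surjective (LinearMap.toSpanSingleton R N g) := fun x => by
    obtain ⟨q, hq⟩ := Ideal.Quotient.mk_surjective (e x)
    exact ⟨f q, by rw [LinearMap.toSpanSingleton_apply, hg, hq, e.symm_apply_apply]⟩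
  have hker : LinearMap.ker (LinearMap.toSpanSingleton R N g) = Ideal.span {f p ^ k} := by
    ext a
    obtain ⟨q, rfl⟩ := hf a
    rw [LinearMap.mem_ker, LinearMap.toSpanSingleton_apply]
    constructor
    · intro h
      obtain ⟨c, rfl⟩ := (hg_zero q).1 h
      exact Ideal.mem_span_singleton'.2 ⟨f c, by rw [mul_comm, map_mul, map_pow]⟩
    · intro h
      obtain ⟨b, hb⟩ := Ideal.mem_span_singleton'.1 h
      rw [← hb, mul_smul, ← map_pow, (hg_zero _).2 dvd_rfl, smul_zero]
  refine ⟨k, (pow_dvd_pow_iff hp.ne_zero hp.not_isUnit).1 ((hg_zero _).1 ?_), ⟨?_⟩⟩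
  · rw [map_pow, hm, zero_smul]
  · exact ((Submodule.quotEquivOfEq _ _ hker).symm ≪≫ₗ
      LinearMap.quotKerEquivOfSurjective _ hsurj).symm

end PrincipalIdealRing

end IsIndecomposableModule

theorem isFiniteRepType_of_surjective {P : Type*} [CommRing P] [IsDomain P]
    [IsPrincipalIdealRing P] {p : P} (hp : Irreducible p) {A : Type u} [Ring A] {f : P →+* Aᵐᵒᵖ}
    (hf : Function.Surjective f) (hfp : IsNilpotent (f p)) : IsFiniteRepType A := by
  obtain ⟨m, hm⟩ := hfp
  refine ⟨m + 1, fun k => .of Aᵐᵒᵖ (Aᵐᵒᵖ ⧸ Ideal.span {f p ^ (k : ℕ)}), fun N _ hN => ?_⟩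
  obtain ⟨k, hk, e⟩ := hN.exists_equiv_quotient_span_pow hp hf hm
  exact ⟨⟨k, Nat.lt_succ_of_le hk⟩, e⟩

namespace IsRegularVertex

variable {V : Type*} [Quiver V] {i : V} (hi : IsRegularVertex 1 i)

include hi

theorem subsingleton_star : Subsingleton (Quiver.Star i) :=
  (Nat.card_eq_one_iff_unique.1 hi.2).1

theorem subsingleton_costar : Subsingleton (Quiver.Costar i) :=
  (Nat.card_eq_one_iff_unique.1 hi.1).1

theorem eq_of_loop (hconn : IsConnectedQuiver V) (γ : i ⟶ i) (a : V) : a = i := by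
  obtain ⟨p⟩ := (Quiver.WeaklyConnectedComponent.eq i a).1 (hconn.2 i a)
  induction p with
  | nil => rfl
  | @cons b c q α ih =>
    obtain rfl : b = i := ih
    rcases α with α | α
    · exact congrArg Sigma.fst (hi.subsingleton_star.elim ⟨c, α⟩ ⟨b, γ⟩)
    · exact congrArg Sigma.fst (hi.subsingleton_costar.elim ⟨c, α⟩ ⟨b, γ⟩)

theorem loop_eq (γ δ : i ⟶ i) : δ = γ := by
  simpa using hi.subsingleton_star.elim ⟨i, δ⟩ ⟨i, γ⟩

end IsRegularVertex

namespace PathAlgebra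

variable {K : Type w} [Field K] {V : Type u} [Quiver.{v} V] [Fintype V]

theorem ofPath_eq_pow_of_loop {i : V} (hV : ∀ a, a = i) {γ : i ⟶ i} (hγ : ∀ δ, δ = γ)
    {a b : V} (p : Quiver.Path a b) :
    (ofPath p : PathAlgebra K V) = ofPath γ.toPath ^ p.length := by
  induction p with
  | nil =>
    rw [Quiver.Path.length_nil, pow_zero, one_def, Fintype.sum_eq_single a]
    exact fun b hb => absurd ((hV b).trans (hV a).symm) hb
  | @cons b c q δ ih =>
    obtain rfl := hV b
    obtain rfl := hV c
    rw [Quiver.Path.length_cons, pow_succ, ← ih, hγ δ, ofPath_cons]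

theorem isFiniteRepType_of_loop {I : Ideal (PathAlgebra K V)} [I.IsTwoSided]
    (hconn : IsConnectedQuiver V) (hI : IsAdmissible I) {i : V} (hi : IsRegularVertex 1 i)
    (γ : i ⟶ i) : IsFiniteRepType (PathAlgebra K V ⧸ I) := by
  let g : (PathAlgebra K V ⧸ I)ᵐᵒᵖ := .op (Ideal.Quotient.mk I (ofPath γ.toPath))
  have hg : g ∈ (Polynomial.aeval (R := K) g).range := ⟨.X, Polynomial.aeval_X g⟩
  have hmem (f : PathAlgebra K V) :
      .op (Ideal.Quotient.mkₐ K I f) ∈ (Polynomial.aeval (R := K) g).range := by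
    induction f using induction_ofPath with
    | h0 => rw [map_zero]; exact zero_mem _
    | hadd f₁ f₂ h₁ h₂ => rw [map_add]; exact add_mem h₁ h₂
    | hsmul c a b p =>
      rw [map_smul, ofPath_eq_pow_of_loop (hi.eq_of_loop hconn γ) (hi.loop_eq γ), map_pow]
      exact Subalgebra.smul_mem _ (pow_mem hg _) c
  refine isFiniteRepType_of_surjective (f := (Polynomial.aeval (R := K) g : K[X] →+* _))
    Polynomial.irreducible_X (fun a => ?_) ?_
  · obtain ⟨f, hf⟩ := Ideal.Quotient.mk_surjective a.unop
    obtain ⟨q, hq⟩ := hmem f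
    exact ⟨q, hq.trans (congrArg MulOpposite.op hf)⟩
  · obtain ⟨m, hm⟩ := hI.isNilpotent_mk (ofPath_mem_arrowIdeal (p := γ.toPath) le_rfl)
    refine ⟨m, ?_⟩
    rw [RingHom.coe_coe, Polynomial.aeval_X, ← MulOpposite.op_pow, hm, MulOpposite.op_zero]

end PathAlgebra

end

theorem lemma4p4_general {K : Type w} [Field K] {V : Type u} [Fintype V] [Quiver.{v} V]
    [∀ a b : V, Finite (a ⟶ b)] {I : Ideal (PathAlgebra K V)} [I.IsTwoSided]
    (hI : PathAlgebra.IsAdmissible I) (hsymm : IsSymmetricKAlgebra K (PathAlgebra K V ⧸ I))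
    (hper : IsNthSyzygy 4 (regularBimodule K (PathAlgebra K V ⧸ I))
      (regularBimodule K (PathAlgebra K V ⧸ I)))
    {x i j : V} (γ : x ⟶ i) (α : i ⟶ j) (β : j ⟶ x) (hi : IsRegularVertex 1 i)
    (hloop : IsEmpty (i ⟶ i)) :
    (2 ≤ Nat.card (Quiver.Costar x) ∧ 2 ≤ Nat.card (Quiver.Star x)) ∧
      2 ≤ Nat.card (Quiver.Costar j) ∧ 2 ≤ Nat.card (Quiver.Star j) := by
  classical
  have := hI.finiteDimensional
  have := IsNoetherianRing.of_finite K (PathAlgebra K V ⧸ I)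
  let S := hI.basicIdempotents
  have hS := S.nonempty_periodicResolution_of_isNthSyzygy_regularBimodule hper
  have hn {a b : V} (δ : a ⟶ b) : S.extDim b a ≠ 0 := by
    have : Nonempty (a ⟶ b) := ⟨δ⟩
    rw [hI.extDim_basicIdempotents]
    exact Nat.card_pos.ne'
  have hin (a : V) : Nat.card (Quiver.Costar a) = ∑ c, S.extDim a c := by
    simp only [S, hI.extDim_basicIdempotents]
    exact Nat.card_sigma
  have hout (a : V) : Nat.card (Quiver.Star a) = ∑ c, S.extDim c a := by
    simp only [S, hI.extDim_basicIdempotents]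
    exact Nat.card_sigma
  rw [hin, hin, hout, hout]
  refine two_le_degrees_of_triangle (S.sum_extDim_mul_cartan hsymm hS)
    (S.cartan_add_extDim_le hsymm hS) ?_ ?_ ?_ (hn γ) (hn α) (hn β)
  · rw [hI.extDim_basicIdempotents, Nat.card_of_isEmpty]
  · rw [← hin, hi.1]
    exact one_lt_two
  · rw [← hout, hi.2]
    exact one_lt_two

theorem lemma4p4 {K : Type w} [Field K] [IsAlgClosed K]
    {V : Type u} [Fintype V] [Quiver.{v} V] [∀ a b : V, Finite (a ⟶ b)]
    (hconn : IsConnectedQuiver V) (hbis : IsBiserialQuiver V)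
    (I : Ideal (PathAlgebra K V)) [I.IsTwoSided] (hI : PathAlgebra.IsAdmissible I)
    (hA : IsTSP4 K (PathAlgebra K V ⧸ I))
    (hinf : ¬ IsFiniteRepType (PathAlgebra K V ⧸ I))
    {x i j : V} (γ : x ⟶ i) (α : i ⟶ j) (β : j ⟶ x) (hi : IsRegularVertex 1 i) :
    IsRegularVertex 2 x ∧ IsRegularVertex 2 j := by
  have h := lemma4p4_general hI hA.symmetric hA.periodic.1.2 γ α β hi
    ⟨fun δ => hinf (PathAlgebra.isFiniteRepType_of_loop hconn hI hi δ)⟩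
  exact ⟨⟨(hbis x).1.antisymm h.1.1, (hbis x).2.antisymm h.1.2⟩,
    (hbis j).1.antisymm h.2.1, (hbis j).2.antisymm h.2.2⟩
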